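/- Let $(R,\mathfrak m_R)$ be an excellent (in particular Noetherian) local ring of Krull dimension $2$, and let $I$ and $J$ be $\mathfrak m_R$-primary ideals of $R$. Write $\ell_R$ for the length of an $R$-module. Then: 1. there is a polynomial $P\in\mathbb Q[t_1,t_2]$ of total degree $2$ such that, for all sufficiently large integers $n_1,n_2$, the length $\ell_R(R/I^{n_1}J^{n_2})$ is finite and equal to $P(n_1,n_2)$; this $P$ is unique, and the mixed multiplicity $e(I,J)$ is by definition the coefficient of $t_1t_2$ in $P$; 2. the limits $e(I)=\lim_{n\to\infty}2!\,\ell_R(R/I^n)/n^2$ and $e(J)=\lim_{n\to\infty}2!\,\ell_R(R/J^n)/n^2$, the Hilbert–Samuel multiplicities of $I$ and $J$, exist in $\mathbb R$; 3. $$e(I,J)^2\le e(I)\,e(J).$$ -/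

import Mathlib

open scoped TensorProduct

universe u

/-! ### Excellent rings -/

/-- A partially ordered set is catenary if the lengths of the finite chains between two given
elements are bounded, and all saturated chains between them have the same length. -/
def IsCatenaryOrder (X : Type u) [PartialOrder X] : Prop :=
  (∀ a b : X, ∃ n : ℕ, ∀ s : LTSeries X, s.head = a → s.last = b → s.length ≤ n) ∧
  ∀ s t : RelSeries {p : X × X | p.1 ⋖ p.2},
    s.head = t.head → s.last = t.last → s.length = t.length

/-- A Noetherian ring is universally catenary if every algebra of finite type over it is catenary.
(Every such algebra has an isomorphic copy in the universe of `R`.) -/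
structure IsUniversallyCatenaryRing (R : Type u) [CommRing R] : Prop where
  isNoetherianRing : IsNoetherianRing R
  catenary : ∀ (S : Type u) [CommRing S] [Algebra R S] [Algebra.FiniteType R S],
    IsCatenaryOrder (PrimeSpectrum S)

/-- A `k`-algebra `S` is geometrically regular if `K ⊗ₖ S` is a regular ring for every finite field
extension `K` of `k`. -/
def IsGeometricallyRegular (k : Type u) [Field k] (S : Type u) [CommRing S] [Algebra k S] : Prop :=
  ∀ (K : Type u) [Field K] [Algebra k K] [Module.Finite k K], IsRegularRing (K ⊗[k] S)

/-- The formal fibres of a local ring `A` are geometrically regular: for every prime `q` of `A`,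
the fibre over `q` of the map from `A` to its completion is geometrically regular over the residue
field of `q`. -/
def HasGeometricallyRegularFormalFibers (A : Type u) [CommRing A] [IsLocalRing A] : Prop :=
  ∀ (q : Ideal A) [q.IsPrime],
    IsGeometricallyRegular q.ResidueField
      (q.ResidueField ⊗[A] AdicCompletion (IsLocalRing.maximalIdeal A) A)

/-- A Grothendieck ring (G-ring): a Noetherian ring, all of whose localizations at primes have
geometrically regular formal fibres. -/
structure IsGrothendieckRing (R : Type u) [CommRing R] : Prop where
  isNoetherianRing : IsNoetherianRing R
  formalFibers : ∀ (p : Ideal R) [p.IsPrime],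
    HasGeometricallyRegularFormalFibers (Localization.AtPrime p)

/-- The regular locus of a ring. -/
def regularLocus (S : Type u) [CommRing S] : Set (PrimeSpectrum S) :=
  {p | IsRegularLocalRing (Localization.AtPrime p.asIdeal)}

/-- A Noetherian ring is J-2 if every algebra of finite type over it has open regular locus. -/
structure IsJTwoRing (R : Type u) [CommRing R] : Prop where
  isNoetherianRing : IsNoetherianRing R
  isOpen_regularLocus : ∀ (S : Type u) [CommRing S] [Algebra R S] [Algebra.FiniteType R S],
    IsOpen (regularLocus S)

/-- An excellent ring: Noetherian, universally catenary, a G-ring, and J-2. -/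
structure IsExcellentRing (R : Type u) [CommRing R] : Prop where
  isNoetherianRing : IsNoetherianRing R
  universallyCatenary : IsUniversallyCatenaryRing R
  grothendieck : IsGrothendieckRing R
  jTwo : IsJTwoRing R

/-! ### Multiplicities and mixed multiplicities -/

/-- The Krull dimension as a natural number (used for nonzero rings of finite dimension). -/
noncomputable def krullDimNat (R : Type u) [CommRing R] : ℕ :=
  ((ringKrullDim R).unbotD 0).toNat

/-- The sequence `d! * ℓ(R / I ^ n) / n ^ d`, where `d = dim R`. -/
noncomputable def multiplicitySeq {R : Type u} [CommRing R] (I : Ideal R) (n : ℕ) : ℝ :=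
  ((krullDimNat R).factorial : ℝ) * ((Module.length R (R ⧸ I ^ n)).toNat : ℝ)
    / (n : ℝ) ^ krullDimNat R

/-- The Hilbert-Samuel multiplicity `e(I)`, the limit of `d! * ℓ(R / I ^ n) / n ^ d`. -/
noncomputable def hilbertSamuelMultiplicity {R : Type u} [CommRing R] (I : Ideal R) : ℝ :=
  Filter.limUnder Filter.atTop (multiplicitySeq I)

/-- `P` is the Hilbert polynomial of the ideals `I₁, …, I_r`: for all large `n₁, …, n_r` the length
of `R / (I₁ ^ n₁ ⋯ I_r ^ n_r)` is finite and equal to `P(n₁, …, n_r)`. -/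
def IsMultigradedHilbertPolynomial {R : Type u} [CommRing R] {r : ℕ} (I : Fin r → Ideal R)
    (P : MvPolynomial (Fin r) ℚ) : Prop :=
  ∃ N : ℕ, ∀ n : Fin r → ℕ, (∀ i, N ≤ n i) →
    ∃ l : ℕ, Module.length R (R ⧸ ∏ i, I i ^ n i) = l ∧ MvPolynomial.eval (fun i => (n i : ℚ)) P = l

/-- The Hilbert polynomial is unique. -/
theorem IsMultigradedHilbertPolynomial.unique {R : Type u} [CommRing R] {r : ℕ}
    {I : Fin r → Ideal R} {P Q : MvPolynomial (Fin r) ℚ}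
    (hP : IsMultigradedHilbertPolynomial I P) (hQ : IsMultigradedHilbertPolynomial I Q) :
    P = Q := by
  obtain ⟨N, hN⟩ := hP
  obtain ⟨M, hM⟩ := hQ
  refine MvPolynomial.funext_set (fun _ => (Nat.cast : ℕ → ℚ) '' Set.Ici (max N M))
    (fun _ => (Set.Ici_infinite _).image Nat.cast_injective.injOn) ?_
  intro x hx
  choose n hn hnx using fun i => hx i (Set.mem_univ i)
  obtain rfl : (fun i => (n i : ℚ)) = x := funext hnx
  obtain ⟨l, hl, hPl⟩ := hN n fun i => (le_max_left _ _).trans (hn i)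
  obtain ⟨k, hk, hQk⟩ := hM n fun i => (le_max_right _ _).trans (hn i)
  have hlk : l = k := by exact_mod_cast hl.symm.trans hk
  rw [hPl, hQk, hlk]

open Classical in
/-- The mixed multiplicity `e(I₁^[v₁], …, I_r^[v_r])`, for `v₁ + ⋯ + v_r = dim R`: it is
`v₁! ⋯ v_r!` times the coefficient of `t₁ ^ v₁ ⋯ t_r ^ v_r` in the Hilbert polynomial of
`I₁, …, I_r`. -/
noncomputable def mixedMultiplicity {R : Type u} [CommRing R] {r : ℕ} (I : Fin r → Ideal R)
    (v : Fin r → ℕ) : ℚ :=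
  if h : ∃ P, IsMultigradedHilbertPolynomial I P then
    (∏ i, (v i).factorial : ℚ) * h.choose.coeff (Finsupp.equivFunOnFinite.symm v)
  else 0

/-! For large m and n the length of R/I^m J^n is αm² + βmn + γn² plus linear terms. Then e(I) = 2α,
e(J) = 2γ and e(I,J) = β, so the claim reads β² ≤ 4αγ. By the discriminant it suffices that βms ≤
αm² + γs² for all s > 0 and all m > 0 divisible by a fixed k: such pairs realise every positive
rational ratio, and nonpositive ratios are covered by β ≥ 0.

This inequality comes from a two-generated reduction: some I^k contains a and b with I^(n+k) = aI^n
+ bI^n for large n (`exists_reduction`). Put A = a^n, B = b^n. For K of finite colength,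
(A,B)/(A,B)K is a quotient of (R/K)², so ℓ(R/I^(kn)K) ≤ ℓ(R/(A,B)) + 2ℓ(R/K). Comparing (A,B) with
I^(N+2kn) gives ℓ(R/(A,B)) ≤ ℓ(R/I^(N+2kn)) - 2ℓ(R/I^(kn)) + O(n); the O(n) measures how far A, B
are from a regular sequence (`exists_len_span_pow_le`). With K a power of J the leading terms read
αm² + βms + γs² + 2αm² ≤ 4αm² + 2γs².

The polynomial and the reduction both come from Noetherian induction on homogeneous ideals of Rees
algebras, handled as families of components. Three nested relevant primes over ⨁ I^(n+1) would force
cubic growth of ℓ(R/I^n), while dimension 2 allows only quadratic growth; this yields a and b.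
Linear growth would put a power of I inside a principal ideal, against Krull's theorem, so the
degree is exactly 2. -/

/-! ### Lengths of quotients and of subquotients of R. -/

section Length

variable {R : Type u} [CommRing R]

/-- The ideal `A : x`. -/
def colonElt (A : Ideal R) (x : R) : Ideal R :=
  Submodule.comap (LinearMap.mulLeft R x) A

@[simp]
theorem mem_colonElt {A : Ideal R} {x y : R} : y ∈ colonElt A x ↔ x * y ∈ A := Iff.rfl

/-- The colength of an ideal. -/
noncomputable def colen (A : Ideal R) : ℕ∞ := Module.length R (R ⧸ A)

/-- The length of `(A + B) / A`. -/
noncomputable def rlen (A B : Ideal R) : ℕ∞ :=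
  Module.length R (Submodule.map (Submodule.mkQ A) B)

theorem rlen_top (A : Ideal R) : rlen A ⊤ = colen A := by
  rw [rlen, colen, Submodule.map_top, Submodule.range_mkQ, Module.length_top]

theorem length_eq_of_ker_eq {M N P : Type*} [AddCommGroup M] [AddCommGroup N] [AddCommGroup P]
    [Module R M] [Module R N] [Module R P] (f : M →ₗ[R] N) (g : M →ₗ[R] P)
    (hf : Function.Surjective f) (hg : Function.Surjective g)
    (h : LinearMap.ker f = LinearMap.ker g) : Module.length R N = Module.length R P := by
  rw [← (f.quotKerEquivOfSurjective hf).length_eq, ← (g.quotKerEquivOfSurjective hg).length_eq, h]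

/-- The projection from `B` onto `(A + B) / A`. -/
def toRlen (A B : Ideal R) : B →ₗ[R] Submodule.map (Submodule.mkQ A) B :=
  ((Submodule.mkQ A).comp B.subtype).codRestrict _ fun x => ⟨x, x.2, rfl⟩

theorem toRlen_surjective (A B : Ideal R) : Function.Surjective (toRlen A B) := by
  rintro ⟨_, x, hx, rfl⟩
  exact ⟨⟨x, hx⟩, rfl⟩

theorem mem_ker_toRlen {A B : Ideal R} {x : B} : x ∈ LinearMap.ker (toRlen A B) ↔ (x : R) ∈ A := by
  rw [LinearMap.mem_ker, ← Subtype.coe_inj]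
  exact Submodule.Quotient.mk_eq_zero A

theorem rlen_antitone {A A' : Ideal R} (h : A ≤ A') (B : Ideal R) : rlen A' B ≤ rlen A B := by
  have hle : LinearMap.ker (toRlen A B) ≤ LinearMap.ker (toRlen A' B) := fun x hx =>
    mem_ker_toRlen.2 (h (mem_ker_toRlen.1 hx))
  refine Module.length_le_of_surjective
    (((LinearMap.ker (toRlen A B)).liftQ (toRlen A' B) hle).comp
      ((toRlen A B).quotKerEquivOfSurjective (toRlen_surjective A B)).symm.toLinearMap) ?_
  rw [LinearMap.coe_comp]
  refine Function.Surjective.comp ?_ (LinearEquiv.surjective _)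
  intro y
  obtain ⟨x, rfl⟩ := toRlen_surjective A' B y
  exact ⟨Submodule.Quotient.mk x, rfl⟩

theorem rlen_add (A : Ideal R) {C D : Ideal R} (h : C ≤ D) :
    rlen A D = rlen A C + rlen (A ⊔ C) D := by
  have hle : LinearMap.ker (toRlen A D) ≤ LinearMap.ker (toRlen (A ⊔ C) D) := fun x hx =>
    mem_ker_toRlen.2 (Submodule.mem_sup_left (mem_ker_toRlen.1 hx))
  let e := (toRlen A D).quotKerEquivOfSurjective (toRlen_surjective A D)
  let g := ((LinearMap.ker (toRlen A D)).liftQ (toRlen (A ⊔ C) D) hle).comp e.symm.toLinearMap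
  have hg : ∀ x, g (toRlen A D x) = toRlen (A ⊔ C) D x := by
    intro x
    have : e.symm (toRlen A D x) = Submodule.Quotient.mk x := by
      rw [LinearEquiv.symm_apply_eq]; rfl
    simp only [g, LinearMap.comp_apply, LinearEquiv.coe_coe, this]
    rfl
  refine Module.length_eq_add_of_exact (Submodule.inclusion (Submodule.map_mono h)) g
    (Submodule.inclusion_injective _) ?_ ?_
  · intro y
    obtain ⟨x, rfl⟩ := toRlen_surjective _ _ y
    exact ⟨_, hg x⟩
  · intro y
    obtain ⟨x, rfl⟩ := toRlen_surjective _ _ y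
    rw [hg, ← LinearMap.mem_ker, mem_ker_toRlen]
    constructor
    · intro hx
      obtain ⟨a, ha, c, hc, hac⟩ := Submodule.mem_sup.1 hx
      refine ⟨⟨Submodule.mkQ A c, c, hc, rfl⟩, Subtype.ext ?_⟩
      change Submodule.mkQ A c = Submodule.mkQ A x
      rw [← hac, map_add, (Submodule.Quotient.mk_eq_zero A).2 ha |> fun h => (h : A.mkQ a = 0),
        zero_add]
    · rintro ⟨⟨_, c, hc, rfl⟩, hz⟩
      have hz : Submodule.mkQ A c = Submodule.mkQ A x := congrArg Subtype.val hz
      have : (x : R) - c ∈ A := by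
        rw [← Submodule.Quotient.mk_eq_zero A]
        change Submodule.mkQ A (x - c) = 0
        rw [map_sub, hz, sub_self]
      have := Submodule.add_mem_sup this hc
      simpa using this

theorem colen_add (A C : Ideal R) : colen A = rlen A C + colen (A ⊔ C) := by
  rw [← rlen_top, ← rlen_top, rlen_add A le_top]

theorem colen_add_of_le {A C : Ideal R} (h : A ≤ C) : colen A = rlen A C + colen C := by
  rw [colen_add A C, sup_eq_right.2 h]

theorem rlen_mono (A : Ideal R) {C D : Ideal R} (h : C ≤ D) : rlen A C ≤ rlen A D := by
  rw [rlen_add A h]; exact le_self_add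

theorem rlen_sup (C D : Ideal R) : rlen C (C ⊔ D) = rlen C D := by
  rw [rlen, rlen, Submodule.map_sup, Submodule.mkQ_map_self, bot_sup_eq]

theorem rlen_le_add (A C D : Ideal R) : rlen A D ≤ rlen A C + rlen C D := by
  calc rlen A D ≤ rlen A (C ⊔ D) := rlen_mono A le_sup_right
    _ = rlen A C + rlen (A ⊔ C) (C ⊔ D) := rlen_add A le_sup_left
    _ ≤ rlen A C + rlen C (C ⊔ D) := by gcongr; exact rlen_antitone le_sup_right _
    _ = _ := by rw [rlen_sup]

theorem rlen_eq_zero {A B : Ideal R} (h : B ≤ A) : rlen A B = 0 := by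
  rw [rlen, Module.length_eq_zero_iff, Submodule.subsingleton_iff_eq_bot,
    ← LinearMap.le_ker_iff_map, Submodule.ker_mkQ]
  exact h

theorem rlen_pos {A B : Ideal R} (h : ¬ B ≤ A) : 1 ≤ rlen A B := by
  rw [Order.one_le_iff_ne_zero, rlen, ne_eq, Module.length_eq_zero_iff,
    Submodule.subsingleton_iff_eq_bot, ← LinearMap.le_ker_iff_map, Submodule.ker_mkQ]
  exact h

theorem colen_antitone {A A' : Ideal R} (h : A ≤ A') : colen A' ≤ colen A := by
  rw [← rlen_top, ← rlen_top]; exact rlen_antitone h _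

theorem rlen_le_colen (A B : Ideal R) : rlen A B ≤ colen A := by
  rw [← rlen_top]; exact rlen_mono A le_top

theorem colen_top : colen (⊤ : Ideal R) = 0 := by
  rw [← rlen_top, rlen_eq_zero le_rfl]

theorem rlen_congr {A A' B : Ideal R} (h : ∀ x ∈ B, x ∈ A ↔ x ∈ A') : rlen A B = rlen A' B := by
  refine length_eq_of_ker_eq _ _ (toRlen_surjective A B) (toRlen_surjective A' B) ?_
  ext x
  rw [mem_ker_toRlen, mem_ker_toRlen, h x x.2]

theorem rlen_inf (A B : Ideal R) : rlen (B ⊓ A) B = rlen A B :=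
  rlen_congr fun _ hx => ⟨fun h => h.2, fun h => ⟨hx, h⟩⟩

theorem rlen_span_mul (A B : Ideal R) (x : R) :
    rlen A (Ideal.span {x} * B) = rlen (colonElt A x) B := by
  let f : B →ₗ[R] (Ideal.span {x} * B : Ideal R) :=
    ((LinearMap.mulLeft R x).comp B.subtype).codRestrict _ fun y =>
      Ideal.mul_mem_mul (Ideal.mem_span_singleton_self x) y.2
  have hf : Function.Surjective f := by
    rintro ⟨y, hy⟩
    obtain ⟨z, hz, rfl⟩ := Ideal.mem_span_singleton_mul.1 hy
    exact ⟨⟨z, hz⟩, rfl⟩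
  refine length_eq_of_ker_eq ((toRlen A _).comp f) (toRlen _ B)
    ((toRlen_surjective _ _).comp hf) (toRlen_surjective _ _) ?_
  ext y
  rw [mem_ker_toRlen, LinearMap.mem_ker, LinearMap.comp_apply, ← LinearMap.mem_ker,
    mem_ker_toRlen]
  rfl

theorem rlen_span (A : Ideal R) (x : R) : rlen A (Ideal.span {x}) = colen (colonElt A x) := by
  rw [← rlen_top, ← rlen_span_mul, Ideal.mul_top]

theorem colen_eq_colon (A : Ideal R) (x : R) :
    colen A = colen (colonElt A x) + colen (A ⊔ Ideal.span {x}) := by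
  rw [colen_add A (Ideal.span {x}), rlen_span]

/-- Split R/(xx', y) along multiplication by x: (xx', y) : x contains (x', y), and adding x to (xx',
y) gives an ideal containing (x, y). -/
theorem colen_span_pair_mul_le (x x' y : R) :
    colen (Ideal.span {x * x', y}) ≤ colen (Ideal.span {x', y}) + colen (Ideal.span {x, y}) := by
  rw [colen_eq_colon _ x]
  refine add_le_add (colen_antitone ?_) (colen_antitone ?_)
  · rw [Ideal.span_le]
    rintro z (rfl | rfl)
    · exact Ideal.subset_span (by simp)
    · exact Ideal.mul_mem_left _ _ (Ideal.subset_span (by simp))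
  · rw [Ideal.span_le]
    rintro z (rfl | rfl)
    · exact Submodule.mem_sup_right (Ideal.mem_span_singleton_self _)
    · exact Submodule.mem_sup_left (Ideal.subset_span (by simp))

theorem colen_span_pow_pair_le (x y : R) (n : ℕ) :
    colen (Ideal.span {x ^ n, y}) ≤ n * colen (Ideal.span {x, y}) := by
  induction n with
  | zero =>
    have : Ideal.span {x ^ 0, y} = ⊤ :=
      (Ideal.eq_top_iff_one _).2 (Ideal.subset_span (by simp))
    rw [this, colen_top]; simp
  | succ n ih =>
    rw [pow_succ]
    refine (colen_span_pair_mul_le _ _ _).trans ?_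
    rw [Nat.cast_add, add_mul, add_comm]
    simpa using add_le_add_left ih _

theorem colen_span_pow_pow_le (x y : R) (n : ℕ) :
    colen (Ideal.span {x ^ n, y ^ n}) ≤ n * (n * colen (Ideal.span {x, y})) := by
  refine (colen_span_pow_pair_le _ _ _).trans ?_
  gcongr
  rw [Set.pair_comm, Set.pair_comm x]
  exact colen_span_pow_pair_le _ _ _

theorem colen_pow_span_pair_le (x y : R) (n : ℕ) :
    colen (Ideal.span {x, y} ^ n) ≤ n * (n * colen (Ideal.span {x, y})) := by
  refine (colen_antitone ?_).trans (colen_span_pow_pow_le x y n)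
  rw [Ideal.span_le]
  rintro z (rfl | rfl) <;> exact Ideal.pow_mem_pow (Ideal.subset_span (by simp)) n

theorem colen_ne_top_of_pow_le [IsNoetherianRing R] [IsLocalRing R] {A : Ideal R} {n : ℕ}
    (h : IsLocalRing.maximalIdeal R ^ n ≤ A) : colen A ≠ ⊤ := by
  by_cases hA : A = ⊤
  · rw [hA, colen_top]; simp
  have hmin : IsLocalRing.maximalIdeal R ∈ A.minimalPrimes := by
    refine ⟨⟨inferInstance, IsLocalRing.le_maximalIdeal hA⟩, fun q hq _ => ?_⟩
    have := hq.1
    exact Ideal.IsPrime.le_of_pow_le (h.trans hq.2)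
  have := IsLocalRing.quotient_artinian_of_mem_minimalPrimes_of_isLocalRing A hmin
  rw [colen, Module.length_eq_of_surjective (R := R ⧸ A) Ideal.Quotient.mk_surjective]
  exact Module.length_ne_top

end Length

/-! ### Homogeneous ideals as families of components. -/

section Graded

variable {R : Type u} [CommRing R] {Γ : Type*} [AddCancelCommMonoid Γ]

/-- A multiplicative family of ideals indexed by a monoid. -/
structure IsMulFamily (F : Γ → Ideal R) : Prop where
  zero : F 0 = ⊤
  add : ∀ c d, F (c + d) = F c * F d

/-- The family of components of a homogeneous ideal in the Rees algebra `⨁ F c`. -/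
structure IsGradedIdeal (F 𝔞 : Γ → Ideal R) : Prop where
  le : ∀ c, 𝔞 c ≤ F c
  mul_le : ∀ c d, F c * 𝔞 d ≤ 𝔞 (c + d)

/-- The components of a homogeneous prime ideal. -/
structure IsGradedPrime (F 𝔭 : Γ → Ideal R) : Prop extends IsGradedIdeal F 𝔭 where
  ne : 𝔭 ≠ F
  mem_or_mem : ∀ {c d : Γ} {x y : R}, x ∈ F c → y ∈ F d → x * y ∈ 𝔭 (c + d) → x ∈ 𝔭 c ∨ y ∈ 𝔭 d

/-- The homogeneous ideal generated by `𝔞` and the element `x` of degree `d`. -/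
def adjoinElt (F 𝔞 : Γ → Ideal R) (x : R) (d : Γ) : Γ → Ideal R := fun c =>
  𝔞 c ⊔ ⨆ e, ⨆ _ : e + d = c, Ideal.span {x} * F e

/-- The homogeneous ideal `𝔞 : x`, for `x` of degree `d`. -/
def gradedColon (F 𝔞 : Γ → Ideal R) (x : R) (d : Γ) : Γ → Ideal R := fun c =>
  F c ⊓ colonElt (𝔞 (c + d)) x

variable {F 𝔞 𝔟 : Γ → Ideal R} {x : R} {d : Γ}

theorem adjoinElt_add (F 𝔞 : Γ → Ideal R) (x : R) (e d : Γ) :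
    adjoinElt F 𝔞 x d (e + d) = 𝔞 (e + d) ⊔ Ideal.span {x} * F e := by
  rw [adjoinElt]
  congr 1
  refine le_antisymm (iSup₂_le fun e' he' => ?_) (le_iSup₂_of_le e rfl le_rfl)
  rw [add_right_cancel he']

theorem le_adjoinElt (F 𝔞 : Γ → Ideal R) (x : R) (d : Γ) : 𝔞 ≤ adjoinElt F 𝔞 x d :=
  fun _ => le_sup_left

theorem IsMulFamily.mem_adjoinElt (hF : IsMulFamily F) (𝔞 : Γ → Ideal R) (x : R) (d : Γ) :
    x ∈ adjoinElt F 𝔞 x d d := by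
  have := adjoinElt_add F 𝔞 x 0 d
  rw [zero_add] at this
  rw [this, hF.zero, Ideal.mul_top]
  exact Submodule.mem_sup_right (Ideal.mem_span_singleton_self x)

theorem IsMulFamily.self (hF : IsMulFamily F) : IsGradedIdeal F F :=
  ⟨fun _ => le_rfl, fun c d => (hF.add c d).ge⟩

theorem IsGradedIdeal.adjoinElt_le (h : IsGradedIdeal F 𝔟) (hle : 𝔞 ≤ 𝔟) (hx : x ∈ 𝔟 d) :
    adjoinElt F 𝔞 x d ≤ 𝔟 := by
  intro c
  refine sup_le (hle c) (iSup₂_le fun e he => ?_)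
  subst he
  rw [mul_comm]
  exact (Ideal.mul_mono_right ((Ideal.span_singleton_le_iff_mem _).2 hx)).trans (h.mul_le e d)

theorem IsMulFamily.adjoinElt (hF : IsMulFamily F) (h : IsGradedIdeal F 𝔞) (hx : x ∈ F d) :
    IsGradedIdeal F (adjoinElt F 𝔞 x d) := by
  refine ⟨hF.self.adjoinElt_le h.le hx, fun c d' => ?_⟩
  conv_lhs => rw [_root_.adjoinElt]
  rw [Ideal.mul_sup]
  refine sup_le ((h.mul_le c d').trans (le_adjoinElt _ _ _ _ _)) ?_
  simp only [Ideal.mul_iSup]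
  refine iSup₂_le fun e he => ?_
  subst he
  rw [← add_assoc, adjoinElt_add, mul_left_comm, hF.add]
  exact le_sup_right

theorem IsMulFamily.lt_adjoinElt (hF : IsMulFamily F) (hx : x ∉ 𝔞 d) : 𝔞 < _root_.adjoinElt F 𝔞 x d :=
  lt_of_le_of_ne (le_adjoinElt _ _ _ _) fun h => hx (by
    rw [h]; exact hF.mem_adjoinElt _ _ _)

theorem IsMulFamily.gradedColon (hF : IsMulFamily F) (h : IsGradedIdeal F 𝔞) (x : R) (d : Γ) :
    IsGradedIdeal F (gradedColon F 𝔞 x d) := by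
  refine ⟨fun c => inf_le_left, fun c e => Ideal.mul_le.2 fun r hr s hs => ⟨?_, ?_⟩⟩
  · rw [hF.add]; exact Ideal.mul_mem_mul hr hs.1
  · change x * (r * s) ∈ 𝔞 (c + e + d)
    rw [mul_left_comm, add_assoc]
    exact h.mul_le _ _ (Ideal.mul_mem_mul hr hs.2)

theorem IsGradedIdeal.le_gradedColon (h : IsGradedIdeal F 𝔞) (hx : x ∈ F d) :
    𝔞 ≤ gradedColon F 𝔞 x d := by
  refine fun c y hy => ⟨h.le c hy, ?_⟩
  change x * y ∈ 𝔞 (c + d)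
  rw [add_comm]
  exact h.mul_le _ _ (Ideal.mul_mem_mul hx hy)

theorem IsGradedIdeal.lt_gradedColon (h : IsGradedIdeal F 𝔞) (hx : x ∈ F d) {y : R} {c : Γ}
    (hy : y ∈ F c) (hxy : x * y ∈ 𝔞 (d + c)) (hy' : y ∉ 𝔞 c) : 𝔞 < gradedColon F 𝔞 x d := by
  refine lt_of_le_of_ne (h.le_gradedColon hx) fun he => hy' ?_
  rw [he]
  exact ⟨hy, by rw [add_comm] at hxy; exact hxy⟩

theorem IsGradedPrime.gradedColon_eq (h : IsGradedPrime F 𝔞) (hx : x ∈ F d) (hx' : x ∉ 𝔞 d) :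
    gradedColon F 𝔞 x d = 𝔞 := by
  refine le_antisymm (fun c y hy => ?_) (h.le_gradedColon hx)
  refine (h.mem_or_mem hx hy.1 ?_).resolve_left hx'
  rw [add_comm]
  exact hy.2

/-- This trichotomy drives every Noetherian induction below: in the last case the ideals obtained by
adjoining x or y, and the colon by x, are all strictly larger than 𝔞. -/
theorem IsGradedIdeal.eq_or_prime_or (h : IsGradedIdeal F 𝔞) : 𝔞 = F ∨ IsGradedPrime F 𝔞 ∨
    ∃ c d x y, x ∈ F c ∧ y ∈ F d ∧ x * y ∈ 𝔞 (c + d) ∧ x ∉ 𝔞 c ∧ y ∉ 𝔞 d := by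
  by_contra! hc
  exact hc.2.1 ⟨h, hc.1, fun {c d x y} hx hy hxy => by
    by_contra! hn
    exact hn.2 (hc.2.2 c d x y hx hy hxy hn.1)⟩

theorem IsGradedIdeal.induction [WellFoundedGT {𝔞 : Γ → Ideal R // IsGradedIdeal F 𝔞}]
    {motive : (Γ → Ideal R) → Prop}
    (step : ∀ 𝔞, IsGradedIdeal F 𝔞 → (∀ 𝔟, IsGradedIdeal F 𝔟 → 𝔞 < 𝔟 → motive 𝔟) → motive 𝔞)
    (h : IsGradedIdeal F 𝔞) : motive 𝔞 :=
  WellFoundedGT.induction (motive := fun 𝔞 : {𝔞 : Γ → Ideal R // IsGradedIdeal F 𝔞} => motive 𝔞.1)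
    ⟨𝔞, h⟩ fun 𝔞 ih => step 𝔞.1 𝔞.2 fun 𝔟 h𝔟 hlt => ih ⟨𝔟, h𝔟⟩ hlt

end Graded

/-! ### Noetherianity of Rees algebras. -/

section Rees

open Polynomial

variable {R : Type u} [CommRing R] (I J : Ideal R)

/-- The products `I ^ m * J ^ n`. -/
def powMulPow (c : ℕ × ℕ) : Ideal R := I ^ c.1 * J ^ c.2

theorem isMulFamily_powMulPow : IsMulFamily (powMulPow I J) :=
  ⟨by simp [powMulPow], fun c d => by
    simp only [powMulPow, Prod.fst_add, Prod.snd_add, pow_add]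
    exact mul_mul_mul_comm _ _ _ _⟩

theorem isMulFamily_pow : IsMulFamily (fun n : ℕ => I ^ n) :=
  ⟨by simp, fun c d => pow_add I c d⟩

/-- The Rees algebra of the two ideals `I` and `J`, the direct sum of all `I ^ m * J ^ n`. -/
noncomputable abbrev biReesAlgebra : Subalgebra (reesAlgebra I) (reesAlgebra I)[X] :=
  reesAlgebra (J.map (algebraMap R (reesAlgebra I)))

variable {I J}

theorem coeff_mem_of_mem_map_pow {n : ℕ} {g : reesAlgebra I}
    (hg : g ∈ (J.map (algebraMap R (reesAlgebra I))) ^ n) (m : ℕ) :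
    (g : R[X]).coeff m ∈ I ^ m * J ^ n := by
  rw [← Ideal.map_pow, Ideal.map] at hg
  induction hg using Submodule.span_induction generalizing m with
  | mem x hx =>
    obtain ⟨y, hy, rfl⟩ := hx
    change (C y : R[X]).coeff m ∈ _
    rw [coeff_C]
    split_ifs with h
    · subst h; simpa using hy
    · exact zero_mem _
  | zero => simp
  | add x y _ _ hx hy => simpa using add_mem (hx m) (hy m)
  | smul a x _ hx =>
    rw [smul_eq_mul, Subalgebra.coe_mul, coeff_mul]
    refine Ideal.sum_mem _ fun p hp => ?_
    rw [← Finset.HasAntidiagonal.mem_antidiagonal.1 hp, pow_add, mul_assoc]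
    exact Ideal.mul_mem_mul (a.2 _) (hx _)

/-- The coefficient of bidegree `(m, n)`. -/
noncomputable def biCoeff (f : biReesAlgebra I J) (c : ℕ × ℕ) : R :=
  (((f : (reesAlgebra I)[X]).coeff c.2 : reesAlgebra I) : R[X]).coeff c.1

theorem biCoeff_mem (f : biReesAlgebra I J) (c : ℕ × ℕ) : biCoeff f c ∈ powMulPow I J c :=
  coeff_mem_of_mem_map_pow (f.2 c.2) c.1

theorem biCoeff_mul (f g : biReesAlgebra I J) (c : ℕ × ℕ) :
    biCoeff (f * g) c = ∑ q ∈ Finset.HasAntidiagonal.antidiagonal c.2, ∑ p ∈ Finset.HasAntidiagonal.antidiagonal c.1,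
      biCoeff f (p.1, q.1) * biCoeff g (p.2, q.2) := by
  simp only [biCoeff, Subalgebra.coe_mul, coeff_mul, AddSubmonoidClass.coe_finsetSum,
    finsetSum_coeff]

/-- The ideal of the Rees algebra whose components are the given ideals. -/
def gradedToIdeal (𝔞 : {𝔞 : ℕ × ℕ → Ideal R // IsGradedIdeal (powMulPow I J) 𝔞}) :
    Ideal (biReesAlgebra I J) where
  carrier := {f | ∀ c, biCoeff f c ∈ 𝔞.1 c}
  add_mem' hf hg c := by simpa [biCoeff] using add_mem (hf c) (hg c)
  zero_mem' c := by simp [biCoeff]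
  smul_mem' f g hg c := by
    rw [smul_eq_mul, biCoeff_mul]
    refine Ideal.sum_mem _ fun q hq => Ideal.sum_mem _ fun p hp => ?_
    have : c = (p.1, q.1) + (p.2, q.2) := Prod.ext (Finset.HasAntidiagonal.mem_antidiagonal.1 hp).symm
      (Finset.HasAntidiagonal.mem_antidiagonal.1 hq).symm
    rw [this]
    exact 𝔞.2.mul_le _ _ (Ideal.mul_mem_mul (biCoeff_mem _ _) (hg _))

theorem exists_biCoeff_eq {c : ℕ × ℕ} {x : R} (hx : x ∈ powMulPow I J c) :
    ∃ f : biReesAlgebra I J, ∀ d, biCoeff f d = if d = c then x else 0 := by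
  refine Submodule.mul_induction_on hx (fun y hy z hz => ?_) ?_
  · have h1 : (⟨monomial c.1 y, reesAlgebra.monomial_mem.2 hy⟩ : reesAlgebra I) *
        algebraMap R (reesAlgebra I) z ∈ (J.map (algebraMap R (reesAlgebra I))) ^ c.2 := by
      rw [← Ideal.map_pow]
      exact Ideal.mul_mem_left _ _ (Ideal.mem_map_of_mem _ hz)
    refine ⟨⟨monomial c.2 _, reesAlgebra.monomial_mem.2 h1⟩, fun d => ?_⟩
    simp only [biCoeff, coeff_monomial]
    by_cases h2 : c.2 = d.2
    · rw [if_pos h2]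
      change (monomial c.1 y * C z : R[X]).coeff d.1 = _
      rw [coeff_mul_C, coeff_monomial]
      by_cases h3 : c.1 = d.1
      · rw [if_pos h3, if_pos (Prod.ext h3.symm h2.symm)]
      · rw [if_neg h3, if_neg (fun h => h3 (by rw [h])), zero_mul]
    · rw [if_neg h2, if_neg (fun h => h2 (by rw [h]))]; simp
  · rintro y z ⟨f, hf⟩ ⟨g, hg⟩
    refine ⟨f + g, fun d => ?_⟩
    have : biCoeff (f + g) d = biCoeff f d + biCoeff g d := by simp [biCoeff]
    rw [this, hf, hg]
    split_ifs <;> simp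

/-- Families of components embed strictly monotonically into the ideals of the two-ideal Rees
algebra, which is Noetherian as an iterated Rees algebra. -/
instance [IsNoetherianRing R] :
    WellFoundedGT {𝔞 : ℕ × ℕ → Ideal R // IsGradedIdeal (powMulPow I J) 𝔞} := by
  have : IsNoetherianRing (biReesAlgebra I J) := inferInstance
  refine StrictMono.wellFoundedGT (f := gradedToIdeal (I := I) (J := J)) fun 𝔞 𝔟 hlt => ?_
  refine lt_of_le_of_ne (fun f hf c => hlt.le c (hf c)) fun heq => hlt.not_ge fun c x hx => ?_
  obtain ⟨f, hf⟩ := exists_biCoeff_eq (𝔟.2.le c hx)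
  have hfb : f ∈ gradedToIdeal 𝔟 := by
    intro d
    rw [hf]
    split_ifs with h
    · rw [h]; exact hx
    · exact zero_mem _
  rw [← heq] at hfb
  simpa [hf] using hfb c

/-- Taking the unit ideal as second ideal reduces one grading to two. -/
instance [IsNoetherianRing R] :
    WellFoundedGT {𝔞 : ℕ → Ideal R // IsGradedIdeal (fun n => I ^ n) 𝔞} := by
  let f : {𝔞 : ℕ → Ideal R // IsGradedIdeal (fun n => I ^ n) 𝔞} →
      {𝔞 : ℕ × ℕ → Ideal R // IsGradedIdeal (powMulPow I ⊤) 𝔞} := fun 𝔞 =>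
    ⟨fun c => 𝔞.1 c.1, fun c => by
      simpa [powMulPow, Ideal.top_pow] using 𝔞.2.le c.1, fun c d => by
      simpa [powMulPow, Ideal.top_pow] using 𝔞.2.mul_le c.1 d.1⟩
  refine StrictMono.wellFoundedGT (f := f) fun 𝔞 𝔟 hlt => ?_
  exact lt_of_le_not_ge (fun c => hlt.le c.1) fun h => hlt.not_ge fun n => h (n, 0)

end Rees

/-! ### Eventually polynomial functions and summation. -/

section EventuallyPolynomial

open MvPolynomial

/-- A function agreeing with a polynomial at all pairs of large numbers. -/
def EvPoly (f : ℕ × ℕ → ℚ) : Prop :=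
  ∃ (P : MvPolynomial (Fin 2) ℚ) (N : ℕ), ∀ m n, N ≤ m → N ≤ n → f (m, n) = eval ![(m : ℚ), n] P

theorem EvPoly.zero_of {f : ℕ × ℕ → ℚ} (N : ℕ) (h : ∀ m n, N ≤ m → N ≤ n → f (m, n) = 0) :
    EvPoly f := ⟨0, N, fun m n hm hn => by simp [h m n hm hn]⟩

theorem exists_shift (P : MvPolynomial (Fin 2) ℚ) (a b : ℚ) :
    ∃ Q : MvPolynomial (Fin 2) ℚ, ∀ x y, eval ![x, y] Q = eval ![x + a, y + b] P := by
  refine ⟨bind₁ ![X 0 + C a, X 1 + C b] P, fun x y => ?_⟩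
  induction P using MvPolynomial.induction_on with
  | C r => simp
  | add p q hp hq => simp [hp, hq]
  | mul_X p i hp => fin_cases i <;> simp [hp]

theorem EvPoly.shift_add {f g h : ℕ × ℕ → ℚ} (c d : ℕ × ℕ) (hg : EvPoly g) (hh : EvPoly h)
    (hf : ∀ p, f (p + c) = g (p + c) + h (p + d)) : EvPoly f := by
  obtain ⟨P, N, hP⟩ := hg
  obtain ⟨Q, M, hQ⟩ := hh
  obtain ⟨Q', hQ'⟩ := exists_shift Q (d.1 - c.1) (d.2 - c.2)
  refine ⟨P + Q', N + M + c.1 + c.2, fun m n hm hn => ?_⟩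
  obtain ⟨m, rfl⟩ := Nat.exists_eq_add_of_le' (show c.1 ≤ m by omega)
  obtain ⟨n, rfl⟩ := Nat.exists_eq_add_of_le' (show c.2 ≤ n by omega)
  have h1 := hf (m, n)
  have h2 := hP (m + c.1) (n + c.2) (by omega) (by omega)
  have h3 := hQ (m + d.1) (n + d.2) (by omega) (by omega)
  change f (m + c.1, n + c.2) = g (m + c.1, n + c.2) + h (m + d.1, n + d.2) at h1
  rw [h1, h2, h3, map_add, hQ']
  congr 4
  · push_cast; ring
  · congr 1; push_cast; ring

theorem exists_antidifference_fst (P : MvPolynomial (Fin 2) ℚ) :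
    ∃ Q : MvPolynomial (Fin 2) ℚ, ∀ x y,
      eval ![x + 1, y] Q = eval ![x, y] Q + eval ![x, y] P := by
  induction P using MvPolynomial.induction_on' with
  | monomial u a =>
    -- The Bernoulli polynomials satisfy B_(d+1)(x+1) - B_(d+1)(x) = (d+1)x^d.
    refine ⟨C (a / (u 0 + 1)) * Polynomial.aeval (X 0) (Polynomial.bernoulli (u 0 + 1)) *
      X 1 ^ u 1, fun x y => ?_⟩
    have key : ∀ z : ℚ, eval ![z, y] (Polynomial.aeval (X 0 : MvPolynomial (Fin 2) ℚ)
        (Polynomial.bernoulli (u 0 + 1))) = (Polynomial.bernoulli (u 0 + 1)).eval z := by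
      intro z
      rw [Polynomial.aeval_def, Polynomial.hom_eval₂]
      rw [eval_X, Subsingleton.elim ((eval ![z, y]).comp (algebraMap ℚ _)) (RingHom.id ℚ)]
      rfl
    have h0 : (u 0 : ℚ) + 1 ≠ 0 := by positivity
    simp only [map_mul, eval_C, key, map_pow, eval_X, eval_monomial, add_comm x 1,
      Polynomial.bernoulli_eval_one_add]
    rw [Finsupp.prod_fintype _ _ (by simp), Fin.prod_univ_two]
    simp
    field_simp
  | add p q hp hq =>
    obtain ⟨p', hp⟩ := hp
    obtain ⟨q', hq⟩ := hq
    exact ⟨p' + q', fun x y => by simp only [map_add, hp, hq]; ring⟩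

theorem eval_rename_swap (P : MvPolynomial (Fin 2) ℚ) (x y : ℚ) :
    eval ![x, y] (rename (Equiv.swap 0 1) P) = eval ![y, x] P := by
  rw [eval_rename]
  congr 2
  funext i
  fin_cases i <;> simp

theorem exists_antidifference_snd (P : MvPolynomial (Fin 2) ℚ) :
    ∃ Q : MvPolynomial (Fin 2) ℚ, ∀ x y,
      eval ![x, y + 1] Q = eval ![x, y] Q + eval ![x, y] P := by
  obtain ⟨Q, hQ⟩ := exists_antidifference_fst (rename (Equiv.swap 0 1) P)
  refine ⟨rename (Equiv.swap 0 1) Q, fun x y => ?_⟩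
  simp only [eval_rename_swap, hQ]

theorem exists_specialize_fst (P : MvPolynomial (Fin 2) ℚ) (a : ℚ) :
    ∃ Q : MvPolynomial (Fin 2) ℚ, ∀ x y, eval ![x, y] Q = eval ![a, y] P := by
  refine ⟨bind₁ ![C a, X 1] P, fun x y => ?_⟩
  induction P using MvPolynomial.induction_on with
  | C r => simp
  | add p q hp hq => simp [hp, hq]
  | mul_X p i hp => fin_cases i <;> simp [hp]

/-- Subtracting an antidifference of the first difference leaves a function of n alone on the stable
range; its difference is polynomial, so it can be summed once more. -/
theorem EvPoly.of_differences {f g h : ℕ × ℕ → ℚ} (hg : EvPoly g) (hh : EvPoly h)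
    (h1 : ∀ m n, f (m + 1, n) = f (m, n) + g (m, n))
    (h2 : ∀ m n, f (m, n + 1) = f (m, n) + h (m, n)) : EvPoly f := by
  obtain ⟨P, N, hP⟩ := hg
  obtain ⟨P', N', hP'⟩ := hh
  wlog hN : N = N' generalizing N N'
  · exact this (max N N') (fun m n hm hn => hP m n (by omega) (by omega)) (max N N')
      (fun m n hm hn => hP' m n (by omega) (by omega)) rfl
  subst hN
  obtain ⟨Q, hQ⟩ := exists_antidifference_fst P
  obtain ⟨D, hD⟩ := exists_shift Q 0 1
  -- `S` is the n-difference of f - Q along the line m = N.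
  obtain ⟨S, hS⟩ := exists_specialize_fst (P' - (D - Q)) N
  obtain ⟨T, hT⟩ := exists_antidifference_snd S
  have e1 : ∀ n, N ≤ n → ∀ m, N ≤ m →
      f (m, n) - eval ![(m : ℚ), n] Q = f (N, n) - eval ![(N : ℚ), n] Q := by
    intro n hn m hm
    induction m, hm using Nat.le_induction with
    | base => rfl
    | succ m hm ih =>
      rw [← ih, h1, hP m n hm hn, Nat.cast_succ, hQ]; ring
  have e2 : ∀ n, N ≤ n → f (N, n) - eval ![(N : ℚ), n] Q - eval ![(0 : ℚ), n] T =
      f (N, N) - eval ![(N : ℚ), N] Q - eval ![(0 : ℚ), N] T := by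
    intro n hn
    induction n, hn using Nat.le_induction with
    | base => rfl
    | succ n hn ih =>
      rw [← ih, h2, hP' N n le_rfl hn, Nat.cast_succ, hT, hS]
      have := hD N n
      rw [add_zero] at this
      simp only [map_sub, this]; ring
  obtain ⟨T', hT'⟩ := exists_specialize_fst T 0
  refine ⟨Q + T' + C (f (N, N) - eval ![(N : ℚ), N] Q - eval ![(0 : ℚ), N] T), N,
    fun m n hm hn => ?_⟩
  simp only [map_add, eval_C, hT']
  linear_combination e1 n hn m hm + e2 n hn

end EventuallyPolynomial

/-! ### Hilbert functions are eventually polynomial. -/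

section Hilbert

variable {R : Type u} [CommRing R]

/-- The colength of an ideal, as a natural number. -/
noncomputable def len (A : Ideal R) : ℕ := (colen A).toNat

theorem coe_len {A : Ideal R} (h : colen A ≠ ⊤) : (len A : ℕ∞) = colen A := ENat.natCast_toNat h

theorem len_antitone {A B : Ideal R} (h : colen A ≠ ⊤) (hle : A ≤ B) : len B ≤ len A :=
  ENat.toNat_le_toNat (colen_antitone hle) h

theorem colen_ne_top_mono {A B : Ideal R} (h : colen A ≠ ⊤) (hle : A ≤ B) : colen B ≠ ⊤ :=
  ne_top_of_le_ne_top h (colen_antitone hle)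

/-- Multiplication by x embeds B/(B ∩ (A : x)) into R/A with cokernel R/(A + xB). -/
theorem len_add_len {A B : Ideal R} {x : R} (hA : colen A ≠ ⊤) (hB : colen (B ⊓ colonElt A x) ≠ ⊤) :
    len A + len B = len (A ⊔ Ideal.span {x} * B) + len (B ⊓ colonElt A x) := by
  have h1 := colen_add A (Ideal.span {x} * B)
  have h2 := colen_add_of_le (inf_le_left : B ⊓ colonElt A x ≤ B)
  rw [rlen_span_mul] at h1
  rw [rlen_inf] at h2
  have h3 : colen (A ⊔ Ideal.span {x} * B) ≠ ⊤ := colen_ne_top_mono hA le_sup_left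
  have h4 : colen B ≠ ⊤ := colen_ne_top_mono hB inf_le_left
  have h5 : rlen (colonElt A x) B ≠ ⊤ := by
    rw [h1] at hA
    exact (WithTop.add_ne_top.1 hA).1
  obtain ⟨r, hr⟩ := ENat.ne_top_iff_exists.1 h5
  rw [← coe_len hA, ← coe_len h3, ← hr] at h1
  rw [← coe_len hB, ← coe_len h4, ← hr] at h2
  norm_cast at h1 h2
  omega

/-- The Hilbert function of the module with components `F c / 𝔞 c`. -/
noncomputable def hilb {Γ : Type*} (F 𝔞 : Γ → Ideal R) (c : Γ) : ℚ := len (𝔞 c) - len (F c)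

section

variable {Γ : Type*} [AddCancelCommMonoid Γ] {F 𝔞 : Γ → Ideal R} {x : R} {d : Γ}

theorem IsGradedIdeal.hilb_add (h : IsGradedIdeal F 𝔞)
    (hfin : ∀ c, colen (𝔞 c) ≠ ⊤) (hx : x ∈ F d) (c : Γ) :
    hilb F 𝔞 (c + d) = hilb F (_root_.adjoinElt F 𝔞 x d) (c + d) +
      hilb F (_root_.gradedColon F 𝔞 x d) c := by
  have := len_add_len (B := F c) (x := x) (hfin (c + d))
    (colen_ne_top_mono (hfin c) (h.le_gradedColon hx c))
  rw [← adjoinElt_add] at this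
  have h2 : (len (𝔞 (c + d)) : ℚ) + len (F c) = len (_root_.adjoinElt F 𝔞 x d (c + d)) +
    len (F c ⊓ colonElt (𝔞 (c + d)) x) := by exact_mod_cast this
  simp only [hilb, _root_.gradedColon]
  linarith

end

/-- If 𝔞 is not prime, its Hilbert function is the sum of those of 𝔞 + (x) and of a shift of 𝔞 : x.
If 𝔞 is prime and contains neither F(1,0) nor F(0,1), elements of these degrees outside 𝔞 act
injectively on F/𝔞, so both differences are Hilbert functions of larger ideals. Otherwise F/𝔞
vanishes in large bidegrees. -/
theorem evPoly_hilb [IsNoetherianRing R] {I J : Ideal R} {𝔞 : ℕ × ℕ → Ideal R}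
    (h : IsGradedIdeal (powMulPow I J) 𝔞) (hfin : ∀ c, colen (𝔞 c) ≠ ⊤) :
    EvPoly (hilb (powMulPow I J) 𝔞) := by
  have hF := isMulFamily_powMulPow I J
  revert hfin
  refine IsGradedIdeal.induction (motive := fun 𝔞 => (∀ c, colen (𝔞 c) ≠ ⊤) →
    EvPoly (hilb (powMulPow I J) 𝔞)) ?_ h
  intro 𝔞 h ih hfin
  have ih' : ∀ 𝔟, IsGradedIdeal (powMulPow I J) 𝔟 → 𝔞 < 𝔟 → EvPoly (hilb (powMulPow I J) 𝔟) :=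
    fun 𝔟 hb hlt => ih 𝔟 hb hlt fun c => colen_ne_top_mono (hfin c) (hlt.le c)
  rcases h.eq_or_prime_or with rfl | hp | ⟨c, d, x, y, hx, hy, hxy, hx', hy'⟩
  · exact EvPoly.zero_of 0 fun m n _ _ => sub_self _
  · have vanish : ∀ e : ℕ × ℕ, powMulPow I J e ≤ 𝔞 e → ∀ c,
        hilb (powMulPow I J) 𝔞 (c + e) = 0 := by
      intro e he c
      have : 𝔞 (c + e) = powMulPow I J (c + e) := by
        refine le_antisymm (h.le _) ?_
        rw [hF.add]
        exact (Ideal.mul_mono_right he).trans (h.mul_le c e)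
      rw [hilb, this, sub_self]
    by_cases h1 : powMulPow I J (1, 0) ≤ 𝔞 (1, 0)
    · refine EvPoly.zero_of 1 fun m n hm _ => ?_
      obtain ⟨m, rfl⟩ := Nat.exists_eq_add_of_le' hm
      exact vanish _ h1 (m, n)
    by_cases h2 : powMulPow I J (0, 1) ≤ 𝔞 (0, 1)
    · refine EvPoly.zero_of 1 fun m n _ hn => ?_
      obtain ⟨n, rfl⟩ := Nat.exists_eq_add_of_le' hn
      exact vanish _ h2 (m, n)
    have step : ∀ e : ℕ × ℕ, ¬ powMulPow I J e ≤ 𝔞 e → ∃ g, EvPoly g ∧ ∀ c,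
        hilb (powMulPow I J) 𝔞 (c + e) = hilb (powMulPow I J) 𝔞 c + g c := by
      intro e he
      obtain ⟨x, hx, hx'⟩ := Set.not_subset.1 he
      refine ⟨fun c => hilb (powMulPow I J) (adjoinElt (powMulPow I J) 𝔞 x e) (c + e),
        EvPoly.shift_add 0 e (EvPoly.zero_of (f := fun _ => 0) 0 fun _ _ _ _ => rfl)
          (ih' _ (hF.adjoinElt h hx) (hF.lt_adjoinElt hx')) fun p => by simp, fun c => ?_⟩
      rw [h.hilb_add hfin hx, hp.gradedColon_eq hx hx', add_comm]
    obtain ⟨g, hg, hg'⟩ := step _ h1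
    obtain ⟨k, hk, hk'⟩ := step _ h2
    exact EvPoly.of_differences hg hk (fun m n => hg' (m, n)) fun m n => hk' (m, n)
  · exact EvPoly.shift_add c 0 (ih' _ (hF.adjoinElt h hx) (hF.lt_adjoinElt hx'))
      (ih' _ (hF.gradedColon h x c) (h.lt_gradedColon hx hy hxy hy')) fun p => by
        rw [add_zero]; exact h.hilb_add hfin hx p

theorem isGradedIdeal_mul (I J K : Ideal R) :
    IsGradedIdeal (powMulPow I J) (fun c => K * powMulPow I J c) :=
  ⟨fun _ => Ideal.mul_le_right, fun c d => by
    rw [(isMulFamily_powMulPow I J).add, mul_left_comm]⟩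

/-- The two differences are the Hilbert functions of F/IF and F/JF. -/
theorem evPoly_len [IsNoetherianRing R] {I J : Ideal R}
    (hfin : ∀ c, colen (powMulPow I J c) ≠ ⊤) : EvPoly (fun c => (len (powMulPow I J c) : ℚ)) := by
  refine EvPoly.of_differences
    (evPoly_hilb (isGradedIdeal_mul I J I) fun c => ?_)
    (evPoly_hilb (isGradedIdeal_mul I J J) fun c => ?_) (fun m n => ?_) (fun m n => ?_)
  · convert hfin (c + (1, 0)) using 2
    simp only [powMulPow, Prod.fst_add, Prod.snd_add, add_zero, pow_succ]; ring
  · convert hfin (c + (0, 1)) using 2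
    simp only [powMulPow, Prod.fst_add, Prod.snd_add, add_zero, pow_succ]; ring
  · rw [hilb, add_sub_cancel, powMulPow, powMulPow]
    congr 2
    simp only [pow_succ]; ring
  · rw [hilb, add_sub_cancel, powMulPow, powMulPow]
    congr 2
    simp only [pow_succ]; ring

end Hilbert

/-! ### Homogeneous primes, prime avoidance, and ideals in no relevant prime. -/

section Primes

variable {R : Type u} [CommRing R]

theorem IsGradedIdeal.exists_finite_primes {Γ : Type*} [AddCancelCommMonoid Γ] {F 𝔞 : Γ → Ideal R}
    [WellFoundedGT {𝔞 : Γ → Ideal R // IsGradedIdeal F 𝔞}]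
    (hF : IsMulFamily F) (h : IsGradedIdeal F 𝔞) :
    ∃ s : Set (Γ → Ideal R), s.Finite ∧ (∀ 𝔭 ∈ s, IsGradedPrime F 𝔭 ∧ 𝔞 ≤ 𝔭) ∧
      ∀ 𝔮, IsGradedPrime F 𝔮 → 𝔞 ≤ 𝔮 → ∃ 𝔭 ∈ s, 𝔭 ≤ 𝔮 := by
  refine IsGradedIdeal.induction (motive := fun 𝔞 => ∃ s : Set (Γ → Ideal R), s.Finite ∧
    (∀ 𝔭 ∈ s, IsGradedPrime F 𝔭 ∧ 𝔞 ≤ 𝔭) ∧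
      ∀ 𝔮, IsGradedPrime F 𝔮 → 𝔞 ≤ 𝔮 → ∃ 𝔭 ∈ s, 𝔭 ≤ 𝔮) ?_ h
  intro 𝔞 h ih
  rcases h.eq_or_prime_or with rfl | hp | ⟨c, d, x, y, hx, hy, hxy, hx', hy'⟩
  · exact ⟨∅, Set.finite_empty, by simp, fun 𝔮 hq hle => (hq.ne (le_antisymm hq.le hle)).elim⟩
  · exact ⟨{𝔞}, Set.finite_singleton _, by simpa using hp, fun 𝔮 _ hle => ⟨𝔞, rfl, hle⟩⟩
  · obtain ⟨s, hs, hs1, hs2⟩ := ih _ (hF.adjoinElt h hx) (hF.lt_adjoinElt hx')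
    obtain ⟨t, ht, ht1, ht2⟩ := ih _ (hF.adjoinElt h hy) (hF.lt_adjoinElt hy')
    refine ⟨s ∪ t, hs.union ht, ?_, fun 𝔮 hq hle => ?_⟩
    · rintro 𝔭 (hp | hp)
      · exact ⟨(hs1 𝔭 hp).1, (le_adjoinElt _ _ _ _).trans (hs1 𝔭 hp).2⟩
      · exact ⟨(ht1 𝔭 hp).1, (le_adjoinElt _ _ _ _).trans (ht1 𝔭 hp).2⟩
    · rcases hq.mem_or_mem hx hy (hle _ hxy) with hm | hm
      · obtain ⟨𝔭, hp, hpq⟩ := hs2 𝔮 hq (hq.adjoinElt_le hle hm)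
        exact ⟨𝔭, Or.inl hp, hpq⟩
      · obtain ⟨𝔭, hp, hpq⟩ := ht2 𝔮 hq (hq.adjoinElt_le hle hm)
        exact ⟨𝔭, Or.inr hp, hpq⟩

/-- The powers of an ideal. -/
abbrev powFamily (I : Ideal R) (n : ℕ) : Ideal R := I ^ n

variable {I : Ideal R}

/-- A homogeneous prime of the Rees algebra of `I` not containing all elements of positive
degree. -/
structure IsRelevantPrime (I : Ideal R) (𝔭 : ℕ → Ideal R) : Prop
    extends IsGradedPrime (powFamily I) 𝔭 where
  not_le : ¬ I ≤ 𝔭 1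

variable {𝔭 𝔮 𝔠 : ℕ → Ideal R}

theorem IsRelevantPrime.of_le (h : IsGradedPrime (powFamily I) 𝔭) (hq : IsRelevantPrime I 𝔮)
    (hle : 𝔭 ≤ 𝔮) : IsRelevantPrime I 𝔭 := ⟨h, fun h' => hq.not_le (h'.trans (hle 1))⟩

theorem IsRelevantPrime.pow_mem (hp : IsRelevantPrime I 𝔭) {a : R} {k : ℕ} (ha : a ∈ I ^ k)
    (n : ℕ) (h : a ^ n ∈ 𝔭 (k * n)) : a ∈ 𝔭 k := by
  induction n with
  | zero =>
    -- Exponent 0 would put 1 in degree 0 of 𝔭, hence I in 𝔭 1, which relevance forbids.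
    exfalso
    refine hp.not_le fun y hy => ?_
    have := hp.mul_le 1 0 (Ideal.mul_mem_mul (by rwa [powFamily, pow_one]) h)
    simpa using this
  | succ n ih =>
    rw [pow_succ, mul_add, mul_one] at h
    exact (hp.mem_or_mem (by rw [powFamily, pow_mul]; exact Ideal.pow_mem_pow ha n) ha h).elim ih id

theorem IsGradedIdeal.pow_mem {𝔞 : ℕ → Ideal R} (h : IsGradedIdeal (powFamily I) 𝔞) {a : R}
    {k : ℕ} (ha : a ∈ 𝔞 k) {n : ℕ} (hn : n ≠ 0) : a ^ n ∈ 𝔞 (k * n) := by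
  obtain ⟨n, rfl⟩ := Nat.exists_eq_succ_of_ne_zero hn
  rw [Nat.succ_eq_add_one, pow_succ, mul_add, mul_one]
  refine h.mul_le _ _ (Ideal.mul_mem_mul ?_ ha)
  rw [powFamily, pow_mul]
  exact Ideal.pow_mem_pow (h.le _ ha) n

theorem IsRelevantPrime.exists_mem_forall (hp : IsRelevantPrime I 𝔭) {s : Set (ℕ → Ideal R)}
    (hs : s.Finite) (h : ∀ 𝔮 ∈ s, IsGradedIdeal (powFamily I) 𝔮 ∧ ¬ 𝔮 ≤ 𝔭) :
    ∃ j > 0, ∃ g ∈ I ^ j, g ∉ 𝔭 j ∧ ∀ 𝔮 ∈ s, g ∈ 𝔮 j := by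
  induction s, hs using Set.Finite.induction_on with
  | empty =>
    obtain ⟨x, hx, hx'⟩ := Set.not_subset.1 hp.not_le
    exact ⟨1, one_pos, x, by rwa [pow_one], hx', by simp⟩
  | @insert 𝔮 s _ _ ih =>
    obtain ⟨j, hj, g, hg, hgp, hgs⟩ := ih fun 𝔮 hq => h 𝔮 (Or.inr hq)
    obtain ⟨hq, hqp⟩ := h 𝔮 (Or.inl rfl)
    obtain ⟨e, he⟩ := not_forall.1 hqp
    obtain ⟨x, hx, hx'⟩ := Set.not_subset.1 he
    refine ⟨j + e, by omega, g * x, ?_, fun hm => (hp.mem_or_mem hg (hq.le _ hx) hm).elim hgp hx',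
      ?_⟩
    · rw [pow_add]; exact Ideal.mul_mem_mul hg (hq.le _ hx)
    · rintro 𝔮' (rfl | hm)
      · exact hq.mul_le _ _ (Ideal.mul_mem_mul hg hx)
      · rw [mul_comm, add_comm]
        exact (h 𝔮' (Or.inr hm)).1.mul_le _ _ (Ideal.mul_mem_mul (hq.le _ hx) (hgs _ hm))

/-- Homogeneous prime avoidance. -/
theorem exists_forall_notMem {s : Set (ℕ → Ideal R)} (hs : s.Finite)
    (h : ∀ 𝔭 ∈ s, IsRelevantPrime I 𝔭) : ∃ k > 0, ∃ a ∈ I ^ k, ∀ 𝔭 ∈ s, a ∉ 𝔭 k := by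
  induction s, hs using Set.Finite.induction_on with
  | empty => exact ⟨1, one_pos, 0, zero_mem _, by simp⟩
  | @insert 𝔭 s _ hs ih =>
    obtain ⟨k, hk, a, ha, has⟩ := ih fun 𝔮 hq => h 𝔮 (Or.inr hq)
    have hp := h 𝔭 (Or.inl rfl)
    by_cases hap : a ∈ 𝔭 k
    swap
    · refine ⟨k, hk, a, ha, ?_⟩
      rintro 𝔮 (rfl | hq)
      exacts [hap, has _ hq]
    obtain ⟨j, hj, g, hg, hgp, hgs⟩ := hp.exists_mem_forall
      (hs.subset (Set.sep_subset s fun 𝔮 => ¬ 𝔮 ≤ 𝔭)) fun 𝔮 hq =>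
        ⟨(h 𝔮 (Or.inr hq.1)).toIsGradedIdeal, hq.2⟩
    -- The powers bring a and g to the common degree kj. Since a lies in 𝔭 and g does not, the sum
    -- avoids 𝔭 and every prime below it; in the remaining primes g lies and a does not.
    have hnot : a ^ j + g ^ k ∉ 𝔭 (k * j) := fun hm => by
      have h1 := hp.toIsGradedIdeal.pow_mem hap hj.ne'
      have h2 : g ^ k ∈ 𝔭 (j * k) := by
        rw [mul_comm j k]
        simpa using sub_mem hm h1
      exact hgp (hp.pow_mem hg k h2)
    refine ⟨k * j, by positivity, a ^ j + g ^ k, add_mem ?_ ?_, ?_⟩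
    · rw [pow_mul]; exact Ideal.pow_mem_pow ha j
    · rw [mul_comm, pow_mul]; exact Ideal.pow_mem_pow hg k
    · rintro 𝔮 (rfl | hq)
      · exact hnot
      by_cases hqp : 𝔮 ≤ 𝔭
      · exact fun hm => hnot (hqp _ hm)
      · intro hm
        have hq' := h 𝔮 (Or.inr hq)
        have h1 := hq'.toIsGradedIdeal.pow_mem (hgs 𝔮 ⟨hq, hqp⟩) hk.ne'
        rw [mul_comm] at h1
        exact has 𝔮 hq (hq'.pow_mem ha j (by simpa using sub_mem hm h1))

variable [IsNoetherianRing R]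

/-- Avoid the finitely many relevant primes that dominate from below all relevant primes over 𝔠. A
prime over 𝔠 that contains a then strictly contains another relevant one, so cutting by a shortens
chains. -/
theorem IsGradedIdeal.exists_cutting_element (h : IsGradedIdeal (powFamily I) 𝔠) :
    ∃ k > 0, ∃ a ∈ I ^ k, ∀ 𝔮, IsRelevantPrime I 𝔮 → 𝔠 ≤ 𝔮 →
      ∃ 𝔭, IsRelevantPrime I 𝔭 ∧ 𝔠 ≤ 𝔭 ∧ 𝔭 ≤ 𝔮 ∧ a ∉ 𝔭 k := by
  obtain ⟨s, hs, hs1, hs2⟩ := h.exists_finite_primes (isMulFamily_pow I)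
  obtain ⟨k, hk, a, ha, has⟩ := exists_forall_notMem (I := I)
    (hs.subset (Set.sep_subset s fun 𝔭 => IsRelevantPrime I 𝔭)) fun 𝔭 hp => hp.2
  refine ⟨k, hk, a, ha, fun 𝔮 hq hle => ?_⟩
  obtain ⟨𝔭, hp, hpq⟩ := hs2 𝔮 hq.toIsGradedPrime hle
  have hp' := IsRelevantPrime.of_le (hs1 𝔭 hp).1 hq hpq
  exact ⟨𝔭, hp', (hs1 𝔭 hp).2, hpq, has 𝔭 ⟨hp, hp'⟩⟩

/-- A projective Nullstellensatz. In the nonprime case the product of 𝔠 + (x) and 𝔠 + (y) lies in 𝔠,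
because xy does, and both factors are eventually everything. -/
theorem IsGradedIdeal.eventually_eq_pow (h : IsGradedIdeal (powFamily I) 𝔠)
    (hc : ∀ 𝔮, IsRelevantPrime I 𝔮 → ¬ 𝔠 ≤ 𝔮) : ∃ N, ∀ n ≥ N, I ^ n ≤ 𝔠 n := by
  have hF := isMulFamily_pow I
  refine IsGradedIdeal.induction (F := powFamily I)
    (motive := fun 𝔠 => (∀ 𝔮, IsRelevantPrime I 𝔮 → ¬ 𝔠 ≤ 𝔮) → ∃ N, ∀ n ≥ N, I ^ n ≤ 𝔠 n) ?_ h hc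
  intro 𝔠 h ih hc
  rcases h.eq_or_prime_or with rfl | hp | ⟨c, d, x, y, hx, hy, hxy, hx', hy'⟩
  · exact ⟨0, fun n _ => le_rfl⟩
  · have h1 : I ≤ 𝔠 1 := by
      by_contra h1
      exact hc 𝔠 ⟨hp, h1⟩ le_rfl
    refine ⟨1, fun n hn => ?_⟩
    obtain ⟨n, rfl⟩ := Nat.exists_eq_add_of_le' hn
    rw [pow_succ]
    exact (Ideal.mul_mono_right h1).trans (h.mul_le n 1)
  · obtain ⟨N, hN⟩ := ih _ (hF.adjoinElt h hx) (hF.lt_adjoinElt hx') fun 𝔮 hq hle =>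
      hc 𝔮 hq ((le_adjoinElt _ _ _ _).trans hle)
    obtain ⟨M, hM⟩ := ih _ (hF.adjoinElt h hy) (hF.lt_adjoinElt hy') fun 𝔮 hq hle =>
      hc 𝔮 hq ((le_adjoinElt _ _ _ _).trans hle)
    refine ⟨N + c + (M + d), fun n hn => ?_⟩
    obtain ⟨r, rfl⟩ := Nat.exists_eq_add_of_le' hn
    have h1 := hN (r + N + c) (by omega)
    have h2 := hM (M + d) (by omega)
    rw [adjoinElt_add] at h1 h2
    rw [show r + (N + c + (M + d)) = (r + N + c) + (M + d) by ring, pow_add]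
    refine (Ideal.mul_mono h1 h2).trans ?_
    rw [Ideal.sup_mul, Ideal.mul_sup]
    refine sup_le (sup_le ?_ ?_) ?_
    · exact (Ideal.mul_mono_left (h.le _)).trans (h.mul_le _ _)
    · rw [add_comm (r + N + c), mul_comm]
      refine (Ideal.mul_mono_left ?_).trans (h.mul_le _ _)
      rw [mul_comm]
      exact (Ideal.mul_mono_right ((Ideal.span_singleton_le_iff_mem _).2 hy)).trans
        (pow_add I M d).ge
    · rw [Ideal.mul_sup]
      refine sup_le ((Ideal.mul_mono_left ?_).trans (h.mul_le _ _)) ?_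
      · rw [mul_comm]
        exact (Ideal.mul_mono_right ((Ideal.span_singleton_le_iff_mem _).2 hx)).trans
          (pow_add I (r + N) c).ge
      · rw [mul_mul_mul_comm, mul_comm, Ideal.span_singleton_mul_span_singleton,
          show r + N + c + (M + d) = (r + N + M) + (c + d) by ring]
        refine (Ideal.mul_mono ?_ ((Ideal.span_singleton_le_iff_mem _).2 hxy)).trans (h.mul_le _ _)
        rw [← hF.add]

end Primes

/-! ### Chains of relevant primes force growth; existence of reductions. -/

section Growth

variable {R : Type u} [CommRing R] {I : Ideal R} {𝔭 𝔮 : ℕ → Ideal R}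

theorem hilb_nonneg {Γ : Type*} {F 𝔞 : Γ → Ideal R} (hfin : ∀ c, colen (𝔞 c) ≠ ⊤) (h : 𝔞 ≤ F)
    (c : Γ) : 0 ≤ hilb F 𝔞 c :=
  sub_nonneg.2 (by exact_mod_cast len_antitone (hfin c) (h c))

/-- The powers of an x in I outside 𝔮 1 survive in every degree. -/
theorem one_le_hilb (hq : IsRelevantPrime I 𝔮) (hfin : ∀ c, colen (𝔮 c) ≠ ⊤) (n : ℕ) :
    1 ≤ hilb (powFamily I) 𝔮 n := by
  obtain ⟨x, hx, hx'⟩ := Set.not_subset.1 hq.not_le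
  have h1 : ¬ I ^ n ≤ 𝔮 n := fun h => hx' (hq.pow_mem (k := 1) (by rwa [pow_one]) n
    (by rw [one_mul]; exact h (Ideal.pow_mem_pow hx n)))
  have h2 := colen_add_of_le (hq.le n)
  have h3 := rlen_pos h1
  have h4 : colen (powFamily I n) + 1 ≤ colen (𝔮 n) := by
    rw [h2, add_comm]; gcongr
  rw [← coe_len (hfin n), ← coe_len (colen_ne_top_mono (hfin n) (hq.le n))] at h4
  have h5 : (len (powFamily I n) : ℚ) + 1 ≤ len (𝔮 n) := by exact_mod_cast h4
  rw [hilb]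
  linarith

/-- Multiplication by a is injective on F/𝔭 and its cokernel surjects onto F/𝔮, so each step in a
chain of primes raises the order of growth by one. -/
theorem IsGradedPrime.hilb_add_le (hp : IsGradedPrime (powFamily I) 𝔭)
    (hq : IsGradedIdeal (powFamily I) 𝔮)
    (hfin : ∀ c, colen (𝔭 c) ≠ ⊤) (hle : 𝔭 ≤ 𝔮) {a : R} {k : ℕ} (ha : a ∈ 𝔮 k) (ha' : a ∉ 𝔭 k)
    (n : ℕ) : hilb (powFamily I) 𝔭 n + hilb (powFamily I) 𝔮 (n + k) ≤
      hilb (powFamily I) 𝔭 (n + k) := by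
  rw [hp.hilb_add hfin (hq.le k ha), hp.gradedColon_eq (hq.le k ha) ha', add_comm]
  gcongr
  rw [hilb, hilb]
  gcongr
  exact len_antitone (colen_ne_top_mono (hfin _) (le_adjoinElt _ _ _ _ _))
    (hq.adjoinElt_le hle ha _)

/-- The sum telescopes, since 𝔭(kn) ⊇ I^(kn+1) ⊇ I^(k(n+1)). -/
theorem sum_hilb_le (hfinI : ∀ n, colen (I ^ n) ≠ ⊤)
    (hle : ∀ n, I ^ (n + 1) ≤ 𝔭 n) {k : ℕ} (hk : 0 < k) (N : ℕ) :
    ∑ n ∈ Finset.range N, hilb (powFamily I) 𝔭 (k * n) ≤ len (I ^ (k * N)) := by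
  induction N with
  | zero => simp
  | succ N ih =>
    rw [Finset.sum_range_succ]
    have h1 : len (𝔭 (k * N)) ≤ len (I ^ (k * (N + 1))) :=
      len_antitone (hfinI _) ((Ideal.pow_le_pow_right (by rw [mul_add]; omega)).trans (hle _))
    have h2 : (len (𝔭 (k * N)) : ℚ) ≤ len (I ^ (k * (N + 1))) := by exact_mod_cast h1
    rw [hilb]
    linarith

theorem isGradedIdeal_pow_succ (I : Ideal R) :
    IsGradedIdeal (powFamily I) (fun n => I ^ (n + 1)) :=
  ⟨fun n => Ideal.pow_le_pow_right (by omega), fun c d => by rw [powFamily, ← pow_add, add_assoc]⟩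

variable [IsNoetherianRing R]

theorem exists_pow_le_span_singleton (hfin : ∀ n, colen (I ^ n) ≠ ⊤) (hI : I ≤ Ideal.jacobson ⊥)
    {C : ℕ} (hC : ∀ n, len (I ^ n) ≤ C * n) :
    ∃ a ∈ I, ∃ n, I ^ n ≤ Ideal.span {a} := by
  have hF := isMulFamily_pow I
  have h𝔬 := isGradedIdeal_pow_succ I
  obtain ⟨k, hk, a, ha, hcut⟩ := h𝔬.exists_cutting_element
  obtain ⟨N, hN⟩ := (hF.adjoinElt h𝔬 ha).eventually_eq_pow fun 𝔮 hq hle => by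
    have haq : a ∈ 𝔮 k := hle k (hF.mem_adjoinElt _ a k)
    obtain ⟨𝔭, hp, h𝔬p, hpq, hap⟩ := hcut 𝔮 hq ((le_adjoinElt _ _ _ _).trans hle)
    have hfinp : ∀ c, colen (𝔭 c) ≠ ⊤ := fun c => colen_ne_top_mono (hfin _) (h𝔬p c)
    have hfinq : ∀ c, colen (𝔮 c) ≠ ⊤ := fun c => colen_ne_top_mono (hfinp _) (hpq c)
    have grow : ∀ n : ℕ, (n : ℚ) ≤ hilb (powFamily I) 𝔭 (k * n) := by
      intro n
      induction n with
      | zero => simpa using hilb_nonneg hfinp hp.le _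
      | succ n ih =>
        have h1 := hp.hilb_add_le hq.toIsGradedIdeal hfinp hpq haq hap (k * n)
        have h2 := one_le_hilb hq hfinq (k * n + k)
        rw [mul_add, mul_one]
        push_cast
        linarith
    -- With t = Ck and M = 2t + 2 terms, M(M - 1)/2 exceeds the allowed tM.
    have h1 := sum_hilb_le hfin h𝔬p hk (2 * C * k + 2)
    have h2 : ∀ N : ℕ, (N : ℚ) * (N - 1) / 2 ≤
        ∑ n ∈ Finset.range N, hilb (powFamily I) 𝔭 (k * n) := by
      intro N
      induction N with
      | zero => simp
      | succ N ih =>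
        rw [Finset.sum_range_succ]
        have := grow N
        push_cast
        linarith
    have h3 := h2 (2 * C * k + 2)
    have h4 : (len (I ^ (k * (2 * C * k + 2))) : ℚ) ≤ C * (k * (2 * C * k + 2)) := by
      exact_mod_cast hC (k * (2 * C * k + 2))
    have h5 : (0 : ℚ) ≤ C * k := by positivity
    push_cast at h3
    nlinarith
  refine ⟨a, Ideal.pow_le_self hk.ne' ha, N + k, ?_⟩
  have h1 := hN (N + k) (by omega)
  rw [adjoinElt_add, sup_comm, add_comm (N + k) 1, pow_add I 1,
    pow_one] at h1
  exact (Submodule.le_of_le_smul_of_le_jacobson_bot (IsNoetherian.noetherian _) hI h1).trans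
    Ideal.mul_le_left

/-- Cut ⨁ I^(n+1) twice. A relevant prime containing both a and b would top a chain 𝔯 < 𝔭 < 𝔮, whose
cubic growth contradicts `hC`. So no relevant prime contains both, and Nakayama gives the reduction.
-/
theorem exists_reduction (hfin : ∀ n, colen (I ^ n) ≠ ⊤) (hI : I ≤ Ideal.jacobson ⊥)
    {C : ℕ} (hC : ∀ n, len (I ^ n) ≤ C * n ^ 2) :
    ∃ k > 0, ∃ a ∈ I ^ k, ∃ b ∈ I ^ k, ∃ N, ∀ n ≥ N,
      I ^ (n + k) ≤ Ideal.span {a} * I ^ n ⊔ Ideal.span {b} * I ^ n := by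
  have hF := isMulFamily_pow I
  have h𝔬 := isGradedIdeal_pow_succ I
  obtain ⟨k, hk, a, ha, hcut⟩ := h𝔬.exists_cutting_element
  have h𝔬a := hF.adjoinElt h𝔬 ha
  obtain ⟨l, hl, b, hb, hcut'⟩ := h𝔬a.exists_cutting_element
  -- The two cutting elements have degrees k and l; their powers share the degree kl.
  have ha' : a ^ l ∈ I ^ (k * l) := by rw [pow_mul]; exact Ideal.pow_mem_pow ha l
  have hb' : b ^ k ∈ I ^ (k * l) := by
    rw [mul_comm, pow_mul]; exact Ideal.pow_mem_pow hb k
  have hK : 0 < k * l := by positivity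
  generalize hKdef : k * l = K at *
  have h𝔠 := hF.adjoinElt (hF.adjoinElt h𝔬 ha') hb'
  obtain ⟨N, hN⟩ := h𝔠.eventually_eq_pow fun 𝔮 hq hle => by
    have hleq : adjoinElt (powFamily I) (fun n => I ^ (n + 1)) (a ^ l) K ≤ 𝔮 :=
      (le_adjoinElt _ _ _ _).trans hle
    have h𝔬q : (fun n => I ^ (n + 1)) ≤ 𝔮 := (le_adjoinElt _ _ _ _).trans hleq
    have haq : a ∈ 𝔮 k := hq.pow_mem ha l (hKdef ▸ hleq K (hF.mem_adjoinElt _ _ _))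
    have hbq : b ^ k ∈ 𝔮 K := hle K (hF.mem_adjoinElt _ _ _)
    obtain ⟨𝔭, hp, hap, hpq, hbp⟩ := hcut' 𝔮 hq (hq.adjoinElt_le h𝔬q haq)
    have h𝔬p := (le_adjoinElt _ _ _ _).trans hap
    have hbp' : b ^ k ∉ 𝔭 K := fun h => hbp (hp.pow_mem hb k (by rwa [mul_comm l k, hKdef]))
    have hap' : a ^ l ∈ 𝔭 K := by
      rw [← hKdef]
      exact hp.toIsGradedIdeal.pow_mem (hap k (hF.mem_adjoinElt _ _ _)) hl.ne'
    obtain ⟨𝔯, hr, h𝔬r, hrp, har⟩ := hcut 𝔭 hp h𝔬p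
    have har' : a ^ l ∉ 𝔯 K := fun h => har (hr.pow_mem ha l (by rwa [hKdef]))
    have hfinr : ∀ c, colen (𝔯 c) ≠ ⊤ := fun c => colen_ne_top_mono (hfin _) (h𝔬r c)
    have hfinp : ∀ c, colen (𝔭 c) ≠ ⊤ := fun c => colen_ne_top_mono (hfinr _) (hrp c)
    have hfinq : ∀ c, colen (𝔮 c) ≠ ⊤ := fun c => colen_ne_top_mono (hfinp _) (hpq c)
    have grow : ∀ n : ℕ, (n : ℚ) ≤ hilb (powFamily I) 𝔭 (K * n) := by
      intro n
      induction n with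
      | zero => simpa using hilb_nonneg hfinp hp.le _
      | succ n ih =>
        have h1 := hp.hilb_add_le hq.toIsGradedIdeal hfinp hpq hbq hbp' (K * n)
        have h2 := one_le_hilb hq hfinq (K * n + K)
        rw [mul_add, mul_one]
        push_cast
        linarith
    have grow' : ∀ n : ℕ, (n : ℚ) * (n + 1) / 2 ≤ hilb (powFamily I) 𝔯 (K * n) := by
      intro n
      induction n with
      | zero => simpa using hilb_nonneg hfinr hr.le _
      | succ n ih =>
        have h1 := hr.hilb_add_le hp.toIsGradedIdeal hfinr hrp hap' har' (K * n)
        have h2 := grow (n + 1)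
        rw [show K * (n + 1) = K * n + K by ring] at h2 ⊢
        push_cast at h2 ⊢
        linarith
    -- With t = CK² and M = 6t + 2 terms, (M - 1)M(M + 1)/6 exceeds the allowed tM².
    have h1 := sum_hilb_le hfin h𝔬r hK (6 * C * K ^ 2 + 2)
    have h2 : ∀ N : ℕ, ((N : ℚ) - 1) * N * (N + 1) / 6 ≤
        ∑ n ∈ Finset.range N, hilb (powFamily I) 𝔯 (K * n) := by
      intro N
      induction N with
      | zero => simp
      | succ N ih =>
        rw [Finset.sum_range_succ]
        have := grow' N
        push_cast
        linarith
    have h3 := h2 (6 * C * K ^ 2 + 2)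
    have h4 : (len (I ^ (K * (6 * C * K ^ 2 + 2))) : ℚ) ≤
        C * (K * (6 * C * K ^ 2 + 2)) ^ 2 := by
      exact_mod_cast hC (K * (6 * C * K ^ 2 + 2))
    have h5 : (0 : ℚ) ≤ C * K ^ 2 := by positivity
    push_cast at h3
    have h6 := h3.trans (h1.trans h4)
    have h7 : (6 * (C * K ^ 2) + 1 : ℚ) * (6 * (C * K ^ 2) + 2) * (6 * (C * K ^ 2) + 3) / 6 ≤
        (C * K ^ 2) * (6 * (C * K ^ 2) + 2) ^ 2 := by
      refine (le_of_eq ?_).trans (h6.trans (le_of_eq ?_)) <;> ring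
    generalize (C : ℚ) * K ^ 2 = t at h5 h7
    nlinarith
  refine ⟨K, hK, a ^ l, ha', b ^ k, hb', N, fun n hn => ?_⟩
  have h1 := hN (n + K) (by omega)
  -- The component of ⨁ I^(n+1) becomes I · I^(n+K), the term that Nakayama removes.
  rw [adjoinElt_add, adjoinElt_add, sup_assoc, sup_comm, add_comm (n + K) 1, pow_add _ 1,
    pow_one] at h1
  exact Submodule.le_of_le_smul_of_le_jacobson_bot (IsNoetherian.noetherian _) hI h1

end Growth

/-! ### The length inequality coming from a two-generated reduction. -/

section Estimate

variable {R : Type u} [CommRing R]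

theorem rlen_sup_le (A C D : Ideal R) : rlen A (C ⊔ D) ≤ rlen A C + rlen A D := by
  rw [rlen_add A (le_sup_left : C ≤ C ⊔ D)]
  gcongr
  calc rlen (A ⊔ C) (C ⊔ D) ≤ rlen (A ⊔ C) (A ⊔ C ⊔ D) :=
        rlen_mono _ (sup_le_sup_right le_sup_right _)
    _ = rlen (A ⊔ C) D := rlen_sup _ _
    _ ≤ rlen A D := rlen_antitone le_sup_left _

theorem rlen_ne_top_of_mul_le {V W K : Ideal R} (hW : W.FG) (hK : colen K ≠ ⊤) (h : K * W ≤ V) :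
    rlen V W ≠ ⊤ := by
  induction W, hW using Submodule.fg_induction with
  | singleton w =>
    change rlen V (Ideal.span {w}) ≠ ⊤
    rw [rlen_span]
    refine colen_ne_top_mono hK fun y hy => h ?_
    change w * y ∈ K * Ideal.span {w}
    rw [mul_comm w]
    exact Ideal.mul_mem_mul hy (Ideal.mem_span_singleton_self w)
  | sup W₁ W₂ _ _ h₁ h₂ =>
    rw [Ideal.mul_sup] at h
    exact ne_top_of_le_ne_top (WithTop.add_ne_top.2 ⟨h₁ (le_sup_left.trans h),
      h₂ (le_sup_right.trans h)⟩) (rlen_sup_le _ _ _)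

/-- (a, b)/(a, b)K is generated by two elements annihilated by K. -/
theorem colen_mul_span_pair_le (K : Ideal R) (a b : R) :
    colen (Ideal.span {a, b} * K) ≤ colen (Ideal.span {a, b}) + 2 * colen K := by
  rw [colen_add_of_le (Ideal.mul_le_left : Ideal.span {a, b} * K ≤ Ideal.span {a, b}), add_comm,
    two_mul]
  gcongr
  have hsup : Ideal.span {a, b} = Ideal.span {a} ⊔ Ideal.span {b} := Ideal.span_insert _ _
  have key : ∀ x ∈ Ideal.span {a, b}, rlen (Ideal.span {a, b} * K) (Ideal.span {x}) ≤ colen K :=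
    fun x hx => by
      rw [rlen_span]
      exact colen_antitone fun y hy => Ideal.mul_mem_mul hx hy
  calc rlen (Ideal.span {a, b} * K) (Ideal.span {a, b})
      = rlen (Ideal.span {a, b} * K) (Ideal.span {a} ⊔ Ideal.span {b}) := by rw [← hsup]
    _ ≤ _ := rlen_sup_le _ _ _
    _ ≤ _ := add_le_add (key a (Ideal.subset_span (by simp))) (key b (Ideal.subset_span (by simp)))

/-- The a-power torsion of R/V stabilises at some (V : a^s)/V, a finitely generated module killed by
a^s and b, hence of finite length. -/
theorem exists_rlen_colonElt_pow_le [IsNoetherianRing R] {a b : R} {V : Ideal R} (hb : b ∈ V)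
    (hab : colen (Ideal.span {a, b}) ≠ ⊤) :
    ∃ T : ℕ, ∀ n, rlen V (colonElt V (a ^ n)) ≤ T := by
  have hmono : Monotone fun n => colonElt V (a ^ n) := monotone_nat_of_le_succ fun n y hy => by
    change a ^ (n + 1) * y ∈ V
    rw [pow_succ', mul_assoc]
    exact V.mul_mem_left _ hy
  obtain ⟨s, hs⟩ := monotone_stabilizes_iff_noetherian.2 ‹IsNoetherianRing R› ⟨_, hmono⟩
  have hle : ∀ n, colonElt V (a ^ n) ≤ colonElt V (a ^ s) := fun n =>
    (hmono (le_max_left n s)).trans (hs _ (le_max_right n s)).ge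
  have hfin : colen (Ideal.span {a ^ s, b}) ≠ ⊤ :=
    ne_top_of_le_ne_top (WithTop.mul_ne_top (ENat.natCast_ne_top s) hab) (colen_span_pow_pair_le a b s)
  have h := rlen_ne_top_of_mul_le (V := V) (W := colonElt V (a ^ s)) (IsNoetherian.noetherian _)
    hfin (Ideal.mul_le.2 fun r hr y hy => by
      obtain ⟨u, v, rfl⟩ := Ideal.mem_span_pair.1 hr
      rw [add_mul, mul_assoc, mul_right_comm]
      exact add_mem (V.mul_mem_left _ hy) (V.mul_mem_left _ hb))
  obtain ⟨T, hT⟩ := ENat.ne_top_iff_exists.1 h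
  exact ⟨T, fun n => (rlen_mono V (hle n)).trans hT.ge⟩

/-- Filter by powers of b. The layer (b^i)/(b^(i+1)) is R/V_i with V_i = (b^(i+1)) : b^i, and only
its a^n-torsion contributes. The V_i increase, so finitely many occur and one bound serves all n
layers. -/
theorem exists_rlen_span_pow_colonElt_le [IsNoetherianRing R] {a b : R}
    (hab : colen (Ideal.span {a, b}) ≠ ⊤) :
    ∃ T : ℕ, ∀ n : ℕ, rlen (Ideal.span {b ^ n}) (colonElt (Ideal.span {b ^ n}) (a ^ n)) ≤ n * T := by
  let V : ℕ → Ideal R := fun i => colonElt (Ideal.span {b ^ (i + 1)}) (b ^ i)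
  have hbV : ∀ i, b ∈ V i := fun i => by
    rw [mem_colonElt, ← pow_succ]; exact Ideal.mem_span_singleton_self _
  have hmono : Monotone V := monotone_nat_of_le_succ fun i y hy => by
    obtain ⟨z, hz⟩ := Ideal.mem_span_singleton.1 hy
    refine Ideal.mem_span_singleton.2 ⟨z, ?_⟩
    change b ^ i * y = _ at hz
    change b ^ (i + 1) * y = _
    rw [pow_succ', mul_assoc, hz]; ring
  obtain ⟨s, hs⟩ := monotone_stabilizes_iff_noetherian.2 ‹IsNoetherianRing R› ⟨_, hmono⟩
  choose T hT using fun i => exists_rlen_colonElt_pow_le (a := a) (hbV i) hab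
  have hbound : ∀ i n, rlen (V i) (colonElt (V i) (a ^ n)) ≤
      ((∑ j ∈ Finset.range (s + 1), T j : ℕ) : ℕ∞) := by
    intro i n
    have : V i = V (min i s) := by
      rcases le_total i s with h | h
      · rw [min_eq_left h]
      · rw [min_eq_right h]; exact (hs i h).symm
    rw [this]
    refine (hT _ n).trans (Nat.cast_le.2 ?_)
    exact Finset.single_le_sum (f := T) (fun _ _ => Nat.zero_le _)
      (Finset.mem_range.2 (Nat.lt_succ_of_le (min_le_right i s)))
  refine ⟨∑ j ∈ Finset.range (s + 1), T j, fun n => ?_⟩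
  set X := colonElt (Ideal.span {b ^ n}) (a ^ n) with hX
  suffices H : ∀ i ≤ n, rlen (Ideal.span {b ^ i}) X ≤
      i * ((∑ j ∈ Finset.range (s + 1), T j : ℕ) : ℕ∞) from H n le_rfl
  intro i hi
  induction i with
  | zero =>
    rw [pow_zero, Ideal.span_singleton_one, rlen_eq_zero le_top]
    exact zero_le
  | succ i ih =>
    have hsub : Ideal.span {b ^ (i + 1)} ≤ Ideal.span {b ^ i} := by
      rw [Ideal.span_singleton_le_span_singleton]; exact pow_dvd_pow b (Nat.le_succ i)
    have h1 : X ⊓ Ideal.span {b ^ i} = Ideal.span {b ^ i} * colonElt X (b ^ i) := by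
      ext y
      rw [Ideal.mem_span_singleton_mul]
      constructor
      · rintro ⟨hy, hy'⟩
        obtain ⟨z, rfl⟩ := Ideal.mem_span_singleton.1 hy'
        exact ⟨z, hy, rfl⟩
      · rintro ⟨z, hz, rfl⟩
        exact ⟨hz, Ideal.mul_mem_right _ _ (Ideal.mem_span_singleton_self _)⟩
    have h2 : colonElt X (b ^ i) ≤ colonElt (V i) (a ^ n) := by
      intro y hy
      change a ^ n * (b ^ i * y) ∈ Ideal.span {b ^ n} at hy
      change b ^ i * (a ^ n * y) ∈ Ideal.span {b ^ (i + 1)}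
      rw [mul_left_comm]
      exact Ideal.span_singleton_le_span_singleton.2 (pow_dvd_pow b hi) hy
    rw [rlen_add _ (inf_le_left : X ⊓ Ideal.span {b ^ i} ≤ X), add_comm, Nat.cast_succ, add_mul,
      one_mul]
    refine add_le_add ((le_of_eq ?_).trans (ih (by omega))) ?_
    · refine rlen_congr fun y hy => ⟨fun h => ?_, fun h => Submodule.mem_sup_right ⟨hy, h⟩⟩
      exact sup_le hsub inf_le_right h
    · rw [h1, rlen_span_mul]
      exact (rlen_mono _ h2).trans (hbound i n)

/-- In each term of the binomial expansion one of the exponents is at least n. -/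
theorem sup_pow_two_mul_le (A B : Ideal R) (n : ℕ) :
    (A ⊔ B) ^ (2 * n) ≤ (A ^ n ⊔ B ^ n) * (A ⊔ B) ^ n := by
  rw [← Submodule.add_eq_sup, add_pow, Submodule.add_eq_sup]
  refine Finset.sum_induction _ (· ≤ (A ^ n ⊔ B ^ n) * (A ⊔ B) ^ n) (fun _ _ => sup_le) bot_le
    fun m hm => ?_
  refine Ideal.mul_le_left.trans ?_
  rcases le_total n m with h | h
  · obtain ⟨j, rfl⟩ := Nat.exists_eq_add_of_le h
    have hj : j + (2 * n - (n + j)) = n := by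
      have := Finset.mem_range.1 hm; omega
    rw [pow_add, mul_assoc]
    refine Ideal.mul_mono le_sup_left ?_
    conv_rhs => rw [← hj, pow_add]
    exact Ideal.mul_mono (Ideal.pow_right_mono le_sup_left _) (Ideal.pow_right_mono le_sup_right _)
  · rw [show 2 * n - m = n + (n - m) by omega, pow_add, mul_left_comm]
    refine Ideal.mul_mono le_sup_right ?_
    conv_rhs => rw [show n = m + (n - m) by omega, pow_add]
    exact Ideal.mul_mono (Ideal.pow_right_mono le_sup_left _) (Ideal.pow_right_mono le_sup_right _)

variable {I : Ideal R} {k N : ℕ} {a b : R}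

theorem pow_le_of_reduction (ha : a ∈ I ^ k) (hb : b ∈ I ^ k)
    (hN : ∀ n ≥ N, I ^ (n + k) ≤ Ideal.span {a} * I ^ n ⊔ Ideal.span {b} * I ^ n) (n : ℕ) :
    I ^ (N + 2 * (k * n)) ≤
      Ideal.span {a ^ n} * I ^ (N + k * n) ⊔ Ideal.span {b ^ n} * I ^ (N + k * n) := by
  have h1 : ∀ j, I ^ (N + k * j) ≤ (Ideal.span {a} ⊔ Ideal.span {b}) ^ j * I ^ N := by
    intro j
    induction j with
    | zero => simp
    | succ j ih =>
      rw [mul_add, mul_one, ← add_assoc]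
      refine (hN _ (by omega)).trans ?_
      rw [← Ideal.sup_mul, pow_succ', mul_assoc]
      exact Ideal.mul_mono_right ih
  have h2 : Ideal.span {a} ⊔ Ideal.span {b} ≤ I ^ k :=
    sup_le ((Ideal.span_singleton_le_iff_mem _).2 ha) ((Ideal.span_singleton_le_iff_mem _).2 hb)
  rw [show N + 2 * (k * n) = N + k * (2 * n) by ring, ← Ideal.sup_mul]
  refine (h1 (2 * n)).trans ((Ideal.mul_mono_left (sup_pow_two_mul_le _ _ n)).trans ?_)
  rw [mul_assoc, Ideal.span_singleton_pow, Ideal.span_singleton_pow]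
  refine Ideal.mul_mono_right ?_
  rw [add_comm N, pow_add, pow_mul]
  exact Ideal.mul_mono_left (Ideal.pow_right_mono h2 n)

theorem colonElt_le_sup {A B : R} {E M : Ideal R} (h : E ≤ Ideal.span {A} * M ⊔ Ideal.span {B}) :
    colonElt E A ≤ M ⊔ colonElt (Ideal.span {B}) A := by
  intro y hy
  obtain ⟨u, hu, v, hv, huv⟩ := Submodule.mem_sup.1 (h hy)
  obtain ⟨z, hz, rfl⟩ := Ideal.mem_span_singleton_mul.1 hu
  refine Submodule.mem_sup.2 ⟨z, hz, y - z, ?_, by ring⟩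
  have : A * (y - z) = v := by
    change A * z + v = A * y at huv
    rw [mul_sub, ← huv]; ring
  rwa [mem_colonElt, this]

/-- Were a^n, b^n a regular sequence, the colons (a^n) : b^n and (b^n) : a^n would be trivial and no
correction needed; in general the correction is linear in n, which is negligible against n². -/
theorem exists_len_span_pow_le [IsNoetherianRing R] (hfin : ∀ n, colen (I ^ n) ≠ ⊤)
    (ha : a ∈ I ^ k) (hb : b ∈ I ^ k)
    (hN : ∀ n ≥ N, I ^ (n + k) ≤ Ideal.span {a} * I ^ n ⊔ Ideal.span {b} * I ^ n) :
    ∃ T : ℕ, ∀ (n : ℕ) (K : Ideal R), colen K ≠ ⊤ → len (I ^ (k * n) * K) + 2 * len (I ^ (k * n)) ≤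
      len (I ^ (N + 2 * (k * n))) + n * T + 2 * len K := by
  have hab : colen (Ideal.span {a, b}) ≠ ⊤ := by
    refine colen_ne_top_mono (hfin (N + k)) ((hN N le_rfl).trans ?_)
    rw [Ideal.span_insert]
    exact sup_le_sup Ideal.mul_le_left Ideal.mul_le_left
  obtain ⟨T₁, hT₁⟩ := exists_rlen_span_pow_colonElt_le hab
  obtain ⟨T₂, hT₂⟩ := exists_rlen_span_pow_colonElt_le (a := b) (b := a)
    (by rwa [Set.pair_comm])
  refine ⟨T₁ + T₂, fun n K hK => ?_⟩
  have hE := pow_le_of_reduction ha hb hN n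
  have hA : a ^ n ∈ I ^ (k * n) := by rw [pow_mul]; exact Ideal.pow_mem_pow ha n
  have hB : b ^ n ∈ I ^ (k * n) := by rw [pow_mul]; exact Ideal.pow_mem_pow hb n
  have hT₁ := hT₁ n
  have hT₂ := hT₂ n
  generalize a ^ n = A at *
  generalize b ^ n = B at *
  set E := I ^ (N + 2 * (k * n)) with hEdef
  set M := I ^ (N + k * n) with hMdef
  have hEQ : E ≤ Ideal.span {A, B} := by
    rw [Ideal.span_insert]
    exact hE.trans (sup_le_sup Ideal.mul_le_left Ideal.mul_le_left)
  -- Climb E ⊆ E + (B) ⊆ (A, B). The two layers are R/(E : B) and R/((E + (B)) : A), and E ⊆ AM + BM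
  -- bounds these colons from above.
  have key : colen (M ⊔ colonElt (Ideal.span {A}) B) + colen (M ⊔ colonElt (Ideal.span {B}) A) +
      colen (Ideal.span {A, B}) ≤ colen E := by
    rw [colen_add_of_le hEQ, rlen_add E (Ideal.span_mono (by simp) : Ideal.span {B} ≤ _)]
    gcongr
    · rw [rlen_span]
      refine colen_antitone (colonElt_le_sup (hE.trans ?_))
      rw [sup_comm]
      exact sup_le_sup_left Ideal.mul_le_left _
    · refine le_trans ?_ (rlen_mono _ (Ideal.span_mono (by simp) : Ideal.span {A} ≤ _))
      rw [rlen_span]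
      exact colen_antitone (colonElt_le_sup (sup_le (hE.trans
        (sup_le_sup_left Ideal.mul_le_left _)) le_sup_right))
  have hM1 : M ≤ I ^ (k * n) := Ideal.pow_le_pow_right (by omega)
  -- Modulo M, the colon exceeds (D) by length at most nT, and (D) lies in I^(kn).
  have low : ∀ (C D : R) (T : ℕ), D ∈ I ^ (k * n) →
      rlen (Ideal.span {D}) (colonElt (Ideal.span {D}) C) ≤ n * T →
      len (I ^ (k * n)) ≤ len (M ⊔ colonElt (Ideal.span {D}) C) + n * T := by
    intro C D T hD hT
    have h1 := colen_add M (colonElt (Ideal.span {D}) C)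
    have h2 := rlen_le_add M (Ideal.span {D}) (colonElt (Ideal.span {D}) C)
    have h3 := rlen_mono M ((Ideal.span_singleton_le_iff_mem _).2 hD)
    have h4 := colen_add_of_le hM1
    have h5 : rlen M (I ^ (k * n)) ≠ ⊤ := ne_top_of_le_ne_top (hfin _) (rlen_le_colen _ _)
    obtain ⟨r, hr⟩ := ENat.ne_top_iff_exists.1 h5
    rw [← coe_len (hfin _), ← coe_len (hfin _), ← hr] at h4
    rw [← coe_len (hfin _), ← coe_len (colen_ne_top_mono (hfin _) le_sup_left)] at h1
    have h6 : rlen M (colonElt (Ideal.span {D}) C) ≤ r + n * T :=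
      h2.trans (add_le_add (h3.trans hr.ge) hT)
    have h7 : (len M : ℕ∞) ≤ (r + n * T) + len (M ⊔ colonElt (Ideal.span {D}) C) := by
      rw [h1]; gcongr
    norm_cast at h4 h7
    change len M = r + _ at h4
    omega
  have l1 := low A B T₁ hB hT₁
  have l2 := low B A T₂ hA hT₂
  have hQ : colen (Ideal.span {A, B}) ≠ ⊤ := colen_ne_top_mono (hfin _) hEQ
  rw [← coe_len (hfin _), ← coe_len hQ, ← coe_len (colen_ne_top_mono (hfin _) le_sup_left),
    ← coe_len (colen_ne_top_mono (hfin _) le_sup_left)] at key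
  have h8 : colen (I ^ (k * n) * K) ≤ colen (Ideal.span {A, B}) + 2 * colen K := by
    refine (colen_antitone (Ideal.mul_mono_left ?_)).trans (colen_mul_span_pair_le K A B)
    rw [Ideal.span_le]
    rintro _ (rfl | rfl)
    exacts [hA, hB]
  have h9 : colen (I ^ (k * n) * K) ≠ ⊤ := by
    refine ne_top_of_le_ne_top (WithTop.add_ne_top.2 ⟨hQ, WithTop.mul_ne_top ?_ hK⟩) h8
    exact ENat.natCast_ne_top 2
  rw [← coe_len h9, ← coe_len hQ, ← coe_len hK] at h8
  norm_cast at key h8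
  change _ ≤ len E at key
  nlinarith

end Estimate

/-! ### Polynomials in two variables of quadratic growth. -/

section QuadraticPolynomial

open MvPolynomial

/-- The coefficient of `t₁ ^ i * t₂ ^ j`. -/
noncomputable def coeff₂ (P : MvPolynomial (Fin 2) ℚ) (i j : ℕ) : ℚ :=
  P.coeff (Finsupp.equivFunOnFinite.symm ![i, j])

theorem finsupp_fin_two_eq (e : Fin 2 →₀ ℕ) :
    Finsupp.equivFunOnFinite.symm ![e 0, e 1] = e := by
  ext i
  fin_cases i <;> simp

theorem exists_restrict_line (P : MvPolynomial (Fin 2) ℚ) (u v : ℚ) :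
    ∃ p : Polynomial ℚ, (∀ k, p.eval k = eval ![u * k, v * k] P) ∧
      ∀ d, p.coeff d = eval ![u, v] (homogeneousComponent d P) := by
  induction P using MvPolynomial.induction_on' with
  | monomial e a =>
    refine ⟨Polynomial.monomial (e 0 + e 1) (a * (u ^ e 0 * v ^ e 1)), fun k => ?_, fun d => ?_⟩
    · rw [Polynomial.eval_monomial, eval_monomial, Finsupp.prod_fintype _ _ (by simp),
        Fin.prod_univ_two]
      simp
      ring
    · have hdeg : e.degree = e 0 + e 1 := by
        rw [Finsupp.degree_eq_sum, Fin.sum_univ_two]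
      rw [Polynomial.coeff_monomial, homogeneousComponent_of_mem
        (isHomogeneous_monomial a (rfl : e.degree = e.degree)), hdeg]
      by_cases h : e 0 + e 1 = d
      · rw [if_pos h, if_pos h.symm, eval_monomial, Finsupp.prod_fintype _ _ (by simp),
          Fin.prod_univ_two]
        simp
      · rw [if_neg h, if_neg (Ne.symm h), map_zero]
  | add p q hp hq =>
    obtain ⟨p', hp1, hp2⟩ := hp
    obtain ⟨q', hq1, hq2⟩ := hq
    exact ⟨p' + q', fun k => by simp [hp1, hq1], fun d => by simp [hp2, hq2]⟩

theorem Polynomial.degree_le_two_of_abs_le (p : Polynomial ℚ) (C : ℚ) (N : ℕ)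
    (h : ∀ k : ℕ, N ≤ k → |p.eval (k : ℚ)| ≤ C * k ^ 2) : p.degree ≤ 2 := by
  by_contra! hd
  have h1 := Polynomial.abs_div_tendsto_atTop_atTop_of_degree_gt p (Polynomial.X ^ 2)
    (by rwa [Polynomial.degree_X_pow]) (by simp)
  have h2 := h1.comp tendsto_natCast_atTop_atTop
  obtain ⟨k, hk, hk1, hk2⟩ := ((h2.eventually_gt_atTop C).and
    ((Filter.eventually_ge_atTop N).and (Filter.eventually_ge_atTop 1))).exists
  have hpos : (0 : ℚ) < (k : ℚ) ^ 2 := by positivity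
  simp only [Function.comp_apply, Polynomial.eval_pow, Polynomial.eval_X, abs_div,
    abs_of_pos hpos, lt_div_iff₀ hpos] at hk
  exact absurd (h k hk1) (not_le.2 hk)

/-- On a ray through (u, v) the degree d coefficient is the value at (u, v) of the degree d
homogeneous part. Growth kills it for d > 2, and positive integer points determine a polynomial. -/
theorem totalDegree_le_two_of_abs_le (P : MvPolynomial (Fin 2) ℚ) (C : ℚ) (N : ℕ)
    (h : ∀ m n : ℕ, N ≤ m → N ≤ n → |eval ![(m : ℚ), n] P| ≤ C * (m + n) ^ 2) :
    P.totalDegree ≤ 2 := by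
  have key : ∀ d > 2, homogeneousComponent d P = 0 := by
    intro d hd
    refine funext_set (fun _ => (Nat.cast : ℕ → ℚ) '' Set.Ici 1)
      (fun _ => (Set.Ici_infinite _).image Nat.cast_injective.injOn) fun x hx => ?_
    obtain ⟨u, hu, hux⟩ := hx 0 trivial
    obtain ⟨v, hv, hvx⟩ := hx 1 trivial
    obtain rfl : ![(u : ℚ), v] = x := by
      ext i; fin_cases i
      exacts [hux, hvx]
    obtain ⟨p, hp1, hp2⟩ := exists_restrict_line P u v
    rw [← hp2, map_zero]
    refine Polynomial.coeff_eq_zero_of_degree_lt (lt_of_le_of_lt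
      (p.degree_le_two_of_abs_le (C * (u + v) ^ 2) N fun k hk => ?_) (by exact_mod_cast hd))
    have := h (u * k) (v * k) (hk.trans (Nat.le_mul_of_pos_left _ hu))
      (hk.trans (Nat.le_mul_of_pos_left _ hv))
    rw [hp1]
    push_cast at this
    exact this.trans_eq (by ring)
  refine Finset.sup_le fun e he => ?_
  by_contra! hlt
  refine (mem_support_iff.1 he) ?_
  have := congrArg (coeff e) (key e.degree hlt)
  rwa [coeff_homogeneousComponent, if_pos rfl, coeff_zero] at this

theorem eval_of_totalDegree_le_two {P : MvPolynomial (Fin 2) ℚ} (h : P.totalDegree ≤ 2)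
    (x y : ℚ) : eval ![x, y] P = coeff₂ P 2 0 * x ^ 2 + coeff₂ P 1 1 * (x * y) +
      coeff₂ P 0 2 * y ^ 2 + coeff₂ P 1 0 * x + coeff₂ P 0 1 * y + coeff₂ P 0 0 := by
  let S : Finset (ℕ × ℕ) := {(2, 0), (1, 1), (0, 2), (1, 0), (0, 1), (0, 0)}
  let f : ℕ × ℕ → (Fin 2 →₀ ℕ) := fun c => Finsupp.equivFunOnFinite.symm ![c.1, c.2]
  have hf : Function.Injective f := fun c d hcd => by
    have := Finsupp.equivFunOnFinite.symm.injective hcd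
    exact Prod.ext (congrFun this 0) (congrFun this 1)
  have hsub : P.support ⊆ S.map ⟨f, hf⟩ := by
    intro e he
    have h1 := (le_totalDegree he).trans h
    rw [Finsupp.sum_fintype _ _ (by simp), Fin.sum_univ_two] at h1
    refine Finset.mem_map.2 ⟨(e 0, e 1), ?_, finsupp_fin_two_eq e⟩
    generalize e 0 = i at *
    generalize e 1 = j at *
    have hi : i ≤ 2 := by omega
    interval_cases i
    · have hj : j ≤ 2 := by omega
      interval_cases j <;> simp [S]
    · have hj : j ≤ 1 := by omega
      interval_cases j <;> simp [S]
    · have hj : j = 0 := by omega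
      subst hj; simp [S]
  rw [eval_eq', Finset.sum_subset hsub fun e _ he => by rw [notMem_support_iff.1 he, zero_mul],
    Finset.sum_map]
  simp only [S, Fin.prod_univ_two]
  rw [Finset.sum_insert (by decide), Finset.sum_insert (by decide), Finset.sum_insert (by decide),
    Finset.sum_insert (by decide), Finset.sum_insert (by decide), Finset.sum_singleton]
  simp [f, coeff₂]
  ring

end QuadraticPolynomial

/-! ### Leading coefficients as limits. -/

section QuadraticLimit

open Filter Topology

/-- The sequence `f n / n ^ 2` tends to `α`. -/
def HasQuadraticLimit (f : ℕ → ℕ) (α : ℝ) : Prop :=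
  Tendsto (fun n => (f n : ℝ) / (n : ℝ) ^ 2) atTop (𝓝 α)

theorem tendsto_quadratic (α β γ : ℝ) :
    Tendsto (fun n : ℕ => (α * (n : ℝ) ^ 2 + β * n + γ) / (n : ℝ) ^ 2) atTop (𝓝 α) := by
  have h1 : Tendsto (fun n : ℕ => α + β * (n : ℝ)⁻¹ + γ * ((n : ℝ)⁻¹) ^ 2) atTop
      (𝓝 (α + β * 0 + γ * 0 ^ 2)) := by
    have := tendsto_inv_atTop_nhds_zero_nat (𝕜 := ℝ)
    exact (tendsto_const_nhds.add (this.const_mul β)).add ((this.pow 2).const_mul γ)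
  rw [show α + β * 0 + γ * 0 ^ 2 = α by ring] at h1
  refine h1.congr' ?_
  filter_upwards [eventually_ge_atTop 1] with n hn
  have : (n : ℝ) ≠ 0 := by positivity
  field_simp

theorem HasQuadraticLimit.of_eventually_eq {f : ℕ → ℕ} {α β γ : ℝ}
    (h : ∀ᶠ n in atTop, (f n : ℝ) = α * (n : ℝ) ^ 2 + β * n + γ) : HasQuadraticLimit f α := by
  refine (tendsto_quadratic α β γ).congr' ?_
  filter_upwards [h] with n hn
  rw [hn]

theorem HasQuadraticLimit.comp_affine {f : ℕ → ℕ} {α : ℝ} (h : HasQuadraticLimit f α) (c : ℕ)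
    {d : ℕ} (hd : 0 < d) : HasQuadraticLimit (fun n => f (c + d * n)) (α * d ^ 2) := by
  have h1 : Tendsto (fun n : ℕ => c + d * n) atTop atTop :=
    tendsto_atTop_mono (fun n => (Nat.le_mul_of_pos_left n hd).trans (Nat.le_add_left _ _))
      tendsto_id
  have h2 := (h.comp h1).mul (tendsto_quadratic ((d : ℝ) ^ 2) (2 * c * d) ((c : ℝ) ^ 2))
  refine h2.congr' ?_
  filter_upwards [eventually_ge_atTop 1] with n hn
  have h3 : (n : ℝ) ≠ 0 := by positivity
  have h4 : (c : ℝ) + d * n ≠ 0 := by positivity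
  simp only [Function.comp_apply]
  push_cast
  rw [show (d : ℝ) ^ 2 * n ^ 2 + 2 * c * d * n + c ^ 2 = (c + d * n) ^ 2 by ring]
  field_simp

/-- The leading coefficient of a function squeezed between two quadratic polynomials. -/
theorem HasQuadraticLimit.of_squeeze {f g : ℕ → ℕ} {α : ℝ} {c N : ℕ}
    (hg : HasQuadraticLimit g α)
    (h1 : ∀ n ≥ N, f n ≤ g n) (h2 : ∀ n ≥ N, g n ≤ f (n + c)) : HasQuadraticLimit f α := by
  have h3 := hg.comp_affine c one_pos
  simp only [one_mul, Nat.cast_one, one_pow, mul_one] at h3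
  have h4 : Tendsto (fun n : ℕ => (f (n + c) : ℝ) / (n : ℝ) ^ 2) atTop (𝓝 α) := by
    refine tendsto_of_tendsto_of_tendsto_of_le_of_le' hg h3 ?_ ?_
    · filter_upwards [eventually_ge_atTop N] with n hn
      gcongr
      exact h2 n hn
    · filter_upwards [eventually_ge_atTop N] with n hn
      rw [add_comm]
      gcongr
      exact h1 _ (by omega)
  refine (tendsto_add_atTop_iff_nat c).1 ?_
  have h5 : Tendsto (fun n : ℕ => ((1 : ℝ) * (n : ℝ) ^ 2 + 2 * c * n + c ^ 2) / (n : ℝ) ^ 2) atTop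
    (𝓝 1) := tendsto_quadratic _ _ _
  have h6 := h4.div h5 one_ne_zero
  rw [div_one] at h6
  refine h6.congr' ?_
  filter_upwards [eventually_ge_atTop 1] with n hn
  have h7 : (n : ℝ) ≠ 0 := by positivity
  have h8 : (n : ℝ) + c ≠ 0 := by positivity
  simp only [Pi.div_apply]
  push_cast
  rw [show (1 : ℝ) * n ^ 2 + 2 * c * n + c ^ 2 = (n + c) ^ 2 by ring]
  field_simp

end QuadraticLimit

/-! ### Assembly for m-primary ideals in dimension 2. -/

section Main

open Filter Topology IsLocalRing

variable {R : Type u} [CommRing R] [IsLocalRing R] {I J : Ideal R}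

theorem le_maximalIdeal_of_radical_eq (hI : I.radical = maximalIdeal R) : I ≤ maximalIdeal R :=
  Ideal.le_radical.trans hI.le

theorem height_maximalIdeal_eq_two (hdim : ringKrullDim R = 2) : (maximalIdeal R).height = 2 :=
  WithBot.coe_injective ((maximalIdeal_height_eq_ringKrullDim (R := R)).trans hdim)

variable [IsNoetherianRing R]

theorem exists_maximalIdeal_pow_le (hI : I.radical = maximalIdeal R) :
    ∃ t, maximalIdeal R ^ t ≤ I := by
  rw [← hI]
  exact I.exists_radical_pow_le_of_fg (IsNoetherian.noetherian _)

theorem colen_powMulPow_ne_top (hI : I.radical = maximalIdeal R) (hJ : J.radical = maximalIdeal R)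
    (c : ℕ × ℕ) : colen (powMulPow I J c) ≠ ⊤ := by
  obtain ⟨s, hs⟩ := exists_maximalIdeal_pow_le hI
  obtain ⟨t, ht⟩ := exists_maximalIdeal_pow_le hJ
  refine colen_ne_top_of_pow_le (n := s * c.1 + t * c.2) ?_
  rw [pow_add, pow_mul, pow_mul]
  exact Ideal.mul_mono (Ideal.pow_right_mono hs _) (Ideal.pow_right_mono ht _)

theorem colen_pow_ne_top (hI : I.radical = maximalIdeal R) (n : ℕ) : colen (I ^ n) ≠ ⊤ := by
  simpa [powMulPow] using colen_powMulPow_ne_top hI hI (n, 0)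

theorem exists_parameters (hdim : ringKrullDim R = 2) :
    ∃ x y : R, ∃ t : ℕ, maximalIdeal R ^ t ≤ Ideal.span {x, y} ∧
      Ideal.span {x, y} ≤ maximalIdeal R := by
  obtain ⟨s, hs, hcard⟩ :=
    Ideal.exists_finset_card_eq_height_of_isNoetherianRing (maximalIdeal R)
  classical
  rw [height_maximalIdeal_eq_two hdim] at hcard
  obtain ⟨x, y, -, rfl⟩ := Finset.card_eq_two.1 (by exact_mod_cast hcard : s.card = 2)
  rw [Finset.coe_pair] at hs
  obtain ⟨t, ht⟩ := exists_maximalIdeal_pow_le (I := Ideal.span {x, y}) (by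
    refine le_antisymm ?_ ?_
    · exact (Ideal.IsPrime.radical_le_iff inferInstance).2 hs.1.2
    · rw [Ideal.radical_eq_sInf]
      exact le_sInf fun q hq => hs.2 ⟨hq.2, hq.1⟩ (le_maximalIdeal hq.2.ne_top))
  exact ⟨x, y, t, ht, hs.1.2⟩

/-- A power of a parameter ideal (x, y) lies in I^m J^n, and (x, y)^q has colength at most q² times
that of (x, y). -/
theorem exists_len_powMulPow_le (hdim : ringKrullDim R = 2) (hI : I.radical = maximalIdeal R)
    (hJ : J.radical = maximalIdeal R) :
    ∃ C : ℕ, ∀ m n, len (powMulPow I J (m, n)) ≤ C * (m + n) ^ 2 := by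
  obtain ⟨x, y, t, ht, hle⟩ := exists_parameters hdim
  obtain ⟨r, hr⟩ := exists_maximalIdeal_pow_le hI
  obtain ⟨s, hs⟩ := exists_maximalIdeal_pow_le hJ
  have hfin : colen (Ideal.span {x, y}) ≠ ⊤ := colen_ne_top_of_pow_le ht
  refine ⟨(r + s) ^ 2 * len (Ideal.span {x, y}), fun m n => ?_⟩
  have h1 : Ideal.span {x, y} ^ ((r + s) * (m + n)) ≤ powMulPow I J (m, n) := by
    rw [mul_add, pow_add, pow_mul, pow_mul]
    refine Ideal.mul_mono (Ideal.pow_right_mono ?_ _) (Ideal.pow_right_mono ?_ _)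
    · exact (Ideal.pow_right_mono hle _).trans ((Ideal.pow_le_pow_right (by omega)).trans hr)
    · exact (Ideal.pow_right_mono hle _).trans ((Ideal.pow_le_pow_right (by omega)).trans hs)
  have h2 := (colen_antitone h1).trans (colen_pow_span_pair_le x y _)
  rw [← coe_len hfin, ← coe_len (colen_powMulPow_ne_top hI hJ _)] at h2
  have h3 : len (powMulPow I J (m, n)) ≤
    ((r + s) * (m + n)) * (((r + s) * (m + n)) * len (Ideal.span {x, y})) := by exact_mod_cast h2
  exact h3.trans_eq (by ring)

theorem exists_hilbertPolynomial (hdim : ringKrullDim R = 2) (hI : I.radical = maximalIdeal R)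
    (hJ : J.radical = maximalIdeal R) :
    ∃ (P : MvPolynomial (Fin 2) ℚ) (N : ℕ), P.totalDegree ≤ 2 ∧ ∀ m n : ℕ, N ≤ m → N ≤ n →
      (len (I ^ m * J ^ n) : ℚ) = MvPolynomial.eval ![(m : ℚ), n] P := by
  obtain ⟨P, N, hP⟩ := evPoly_len (colen_powMulPow_ne_top hI hJ)
  obtain ⟨C, hC⟩ := exists_len_powMulPow_le hdim hI hJ
  refine ⟨P, N, totalDegree_le_two_of_abs_le P C N fun m n hm hn => ?_, hP⟩
  rw [← hP m n hm hn, abs_of_nonneg (by positivity)]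
  have h : (len (powMulPow I J (m, n)) : ℚ) ≤ C * (m + n) ^ 2 := by exact_mod_cast hC m n
  exact h

/-- The formula needs the exponent of J to be at least N, so J^0 is out of reach; instead I^(n+cN) ⊆
I^n J^N ⊆ I^n squeezes the limit. -/
theorem hasQuadraticLimit_len_pow {A B : ℕ → ℚ} {α : ℚ} {N : ℕ}
    (hI : I.radical = maximalIdeal R) (hJ : J.radical = maximalIdeal R)
    (h : ∀ n ≥ N, ∀ m ≥ N, (len (I ^ n * J ^ m) : ℚ) = α * n ^ 2 + A m * n + B m) :
    HasQuadraticLimit (fun n => len (I ^ n)) α := by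
  obtain ⟨c, hc⟩ := exists_maximalIdeal_pow_le hJ
  refine HasQuadraticLimit.of_squeeze (g := fun n => len (I ^ n * J ^ N)) (c := c * N) (N := N)
    (HasQuadraticLimit.of_eventually_eq (β := (A N : ℚ)) (γ := (B N : ℚ)) ?_) ?_ ?_
  · filter_upwards [eventually_ge_atTop N] with n hn
    exact_mod_cast h n hn N le_rfl
  · exact fun n _ => len_antitone (colen_powMulPow_ne_top hI hJ (n, N)) Ideal.mul_le_left
  · refine fun n _ => len_antitone (colen_pow_ne_top hI _) ?_
    rw [pow_add, pow_mul]
    refine Ideal.mul_mono_right (Ideal.pow_right_mono ?_ _)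
    exact (Ideal.pow_right_mono (le_maximalIdeal_of_radical_eq hI) c).trans hc

theorem not_exists_len_pow_le_linear (hdim : ringKrullDim R = 2) (hI : I.radical = maximalIdeal R)
    {C : ℕ} (hC : ∀ n, len (I ^ n) ≤ C * n) : False := by
  have hle := le_maximalIdeal_of_radical_eq hI
  obtain ⟨a, ha, n, hn⟩ := exists_pow_le_span_singleton (colen_pow_ne_top hI)
    (hle.trans (jacobson_eq_maximalIdeal ⊥ bot_ne_top).ge) hC
  have hmin : maximalIdeal R ∈ (Ideal.span {a}).minimalPrimes := by
    refine ⟨⟨inferInstance, (Ideal.span_singleton_le_iff_mem _).2 (hle ha)⟩, fun q hq _ => ?_⟩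
    have := hq.1
    rw [← hI]
    exact (Ideal.IsPrime.radical_le_iff hq.1).2 (Ideal.IsPrime.le_of_pow_le (hn.trans hq.2))
  have h1 := Ideal.height_le_one_of_isPrincipal_of_mem_minimalPrimes _ _ hmin
  rw [height_maximalIdeal_eq_two hdim] at h1
  exact absurd h1 (by decide)

theorem exists_linear_bound {α β : ℚ} {N : ℕ} (hI : I.radical = maximalIdeal R)
    (h : ∀ n ≥ N, (len (I ^ n) : ℚ) ≤ α * n + β) : ∃ C : ℕ, ∀ n, len (I ^ n) ≤ C * n := by
  obtain ⟨C, hC⟩ := exists_nat_ge (|α| + |β|)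
  have key : ∀ n ≥ N + 1, len (I ^ n) ≤ C * n := by
    intro n hn
    have h1 : (1 : ℚ) ≤ n := by exact_mod_cast (by omega : 1 ≤ n)
    have h2 := h n (by omega)
    have h3 : α * n ≤ |α| * n := by gcongr; exact le_abs_self α
    have h4 : β ≤ |β| * n := (le_abs_self β).trans (le_mul_of_one_le_right (abs_nonneg β) h1)
    have h5 : (|α| + |β|) * n ≤ C * n := by gcongr
    have h6 : (len (I ^ n) : ℚ) ≤ C * n := by linarith
    exact_mod_cast h6
  refine ⟨C * (N + 1), fun n => ?_⟩
  rcases Nat.eq_zero_or_pos n with rfl | hn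
  · simp [len, colen_top]
  rcases le_total (N + 1) n with h1 | h1
  · refine (key n h1).trans ?_
    rw [mul_assoc]
    exact Nat.mul_le_mul_left _ (Nat.le_mul_of_pos_left _ (by omega))
  · calc len (I ^ n) ≤ len (I ^ (N + 1)) :=
          len_antitone (colen_pow_ne_top hI _) (Ideal.pow_le_pow_right h1)
      _ ≤ C * (N + 1) := key _ le_rfl
      _ ≤ _ := Nat.le_mul_of_pos_right _ hn

/-- The asymptotic consequence of the existence of a two-generated reduction of a power of `I`. -/
theorem exists_mixed_le {α β γ : ℚ} (hdim : ringKrullDim R = 2)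
    (hI : I.radical = maximalIdeal R) (hJ : J.radical = maximalIdeal R)
    (hα : HasQuadraticLimit (fun n => len (I ^ n)) α)
    (hγ : HasQuadraticLimit (fun n => len (J ^ n)) γ)
    (hL : ∀ r > 0, ∀ s > 0, HasQuadraticLimit (fun n => len (I ^ (r * n) * J ^ (s * n)))
      (α * r ^ 2 + β * (r * s) + γ * s ^ 2 : ℚ)) :
    ∃ k > 0, ∀ r > 0, ∀ s > 0, β * ((k * r : ℕ) * (s : ℕ)) ≤
      α * ((k * r : ℕ) : ℚ) ^ 2 + γ * (s : ℚ) ^ 2 := by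
  obtain ⟨C, hC⟩ := exists_len_powMulPow_le hdim hI hI
  obtain ⟨k, hk, a, ha, b, hb, N, hN⟩ := exists_reduction (colen_pow_ne_top hI)
    ((le_maximalIdeal_of_radical_eq hI).trans (jacobson_eq_maximalIdeal ⊥ bot_ne_top).ge)
    (fun n => by simpa [powMulPow] using hC n 0)
  obtain ⟨T, hT⟩ := exists_len_span_pow_le (colen_pow_ne_top hI) ha hb hN
  refine ⟨k, hk, fun r hr s hs => ?_⟩
  have hkr : 0 < k * r := by positivity
  have l1 := (hL (k * r) hkr s hs).add ((hα.comp_affine 0 hkr).const_mul 2)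
  have l2 := ((hα.comp_affine N (show 0 < 2 * (k * r) by positivity)).add
    (tendsto_quadratic 0 (r * T) 0)).add ((hγ.comp_affine 0 hs).const_mul 2)
  have key := le_of_tendsto_of_tendsto l1 l2 (Eventually.of_forall fun n => ?_)
  · have key' : (α * (k * r : ℕ) ^ 2 + β * ((k * r : ℕ) * s) + γ * s ^ 2 : ℚ) +
        2 * (α * (k * r : ℕ) ^ 2) ≤ α * (2 * (k * r) : ℕ) ^ 2 + 0 + 2 * (γ * s ^ 2) := by
      exact_mod_cast key
    push_cast at key' ⊢
    linarith
  -- The estimate at rn with K = J^(sn); dividing by n² erases the linear error.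
  · have h1 := hT (r * n) (J ^ (s * n)) (colen_pow_ne_top hJ _)
    simp only [zero_add, zero_mul, add_zero]
    rw [← mul_div_assoc, ← mul_div_assoc, ← add_div, ← add_div, ← add_div]
    refine div_le_div_of_nonneg_right ?_ (by positivity)
    simp only [← mul_assoc] at h1 ⊢
    have h2 : (len (I ^ (k * r * n) * J ^ (s * n)) : ℝ) + 2 * len (I ^ (k * r * n)) ≤
      len (I ^ (N + 2 * k * r * n)) + r * n * T + 2 * len (J ^ (s * n)) := by exact_mod_cast h1
    linarith

theorem sq_le_of_forall_mul_le {α β γ : ℚ} (hα : 0 ≤ α) (hβ : 0 ≤ β) (hγ : 0 ≤ γ) {k : ℕ}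
    (hk : 0 < k) (h : ∀ r > 0, ∀ s > 0, β * ((k * r : ℕ) * (s : ℕ)) ≤
      α * ((k * r : ℕ) : ℚ) ^ 2 + γ * (s : ℚ) ^ 2) : β ^ 2 ≤ 4 * α * γ := by
  have key : ∀ x : ℚ, 0 ≤ α * (x * x) + (-β) * x + γ := by
    intro x
    rcases le_or_gt x 0 with hx | hx
    · have := mul_nonneg hβ (neg_nonneg.2 hx)
      have := mul_nonneg hα (mul_self_nonneg x)
      linarith
    · have hnum : (0 : ℤ) < x.num := Rat.num_pos.2 hx
      obtain ⟨p, hp⟩ := Int.eq_ofNat_of_zero_le hnum.le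
      have hp0 : 0 < p := by omega
      -- Multiplying the denominator by k makes the ratio kp / (k · den) equal to x.
      have h1 := h p hp0 (k * x.den) (Nat.mul_pos hk x.den_pos)
      have hxd : (p : ℚ) = x * x.den := by
        rw [Rat.mul_den_eq_num, hp]; rfl
      have hd : (0 : ℚ) < ((k : ℚ) * x.den) ^ 2 := by
        have : (0 : ℚ) < x.den := by exact_mod_cast x.den_pos
        positivity
      push_cast at h1
      rw [hxd] at h1
      refine nonneg_of_mul_nonneg_left (b := ((k : ℚ) * x.den) ^ 2) ?_ hd
      linarith
  have := discrim_le_zero key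
  rw [discrim] at this
  linarith

end Main

theorem corollary5p6 {R : Type u} [CommRing R] [IsLocalRing R] (hR : IsExcellentRing R)
    (hdim : ringKrullDim R = 2) (I J : Ideal R)
    (hI : I.IsPrimary) (hIrad : I.radical = IsLocalRing.maximalIdeal R)
    (hJ : J.IsPrimary) (hJrad : J.radical = IsLocalRing.maximalIdeal R) :
    (∃ P : MvPolynomial (Fin 2) ℚ,
      IsMultigradedHilbertPolynomial ![I, J] P ∧ P.totalDegree = 2) ∧
    Filter.Tendsto (multiplicitySeq I) Filter.atTop (nhds (hilbertSamuelMultiplicity I)) ∧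
    Filter.Tendsto (multiplicitySeq J) Filter.atTop (nhds (hilbertSamuelMultiplicity J)) ∧
    (mixedMultiplicity ![I, J] ![1, 1] : ℝ) ^ 2 ≤
      hilbertSamuelMultiplicity I * hilbertSamuelMultiplicity J := by
  have := hR.isNoetherianRing
  obtain ⟨P, N, hdeg, hP⟩ := exists_hilbertPolynomial hdim hIrad hJrad
  have hHilb : IsMultigradedHilbertPolynomial ![I, J] P := by
    refine ⟨N, fun n hn => ⟨len (I ^ n 0 * J ^ n 1), ?_, ?_⟩⟩
    · rw [Fin.prod_univ_two]
      exact (coe_len (colen_powMulPow_ne_top hIrad hJrad (n 0, n 1))).symm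
    · rw [hP _ _ (hn 0) (hn 1)]
      congr 2
      ext i
      fin_cases i <;> rfl
  simp only [eval_of_totalDegree_le_two hdeg] at hP
  set α := coeff₂ P 2 0
  set β := coeff₂ P 1 1 with hβdef
  set γ := coeff₂ P 0 2
  have hα : HasQuadraticLimit (fun n => len (I ^ n)) α :=
    hasQuadraticLimit_len_pow (N := N) (A := fun m => β * m + coeff₂ P 1 0)
      (B := fun m => γ * m ^ 2 + coeff₂ P 0 1 * m + coeff₂ P 0 0) hIrad hJrad
      fun n hn m hm => by rw [hP n m hn hm]; ring
  have hγ : HasQuadraticLimit (fun n => len (J ^ n)) γ :=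
    hasQuadraticLimit_len_pow (N := N) (A := fun m => β * m + coeff₂ P 0 1)
      (B := fun m => α * m ^ 2 + coeff₂ P 1 0 * m + coeff₂ P 0 0) hJrad hIrad
      fun n hn m hm => by rw [mul_comm, hP m n hm hn]; ring
  have hL : ∀ r > 0, ∀ s > 0, HasQuadraticLimit (fun n => len (I ^ (r * n) * J ^ (s * n)))
      (α * r ^ 2 + β * (r * s) + γ * s ^ 2 : ℚ) := by
    intro r hr s hs
    refine HasQuadraticLimit.of_eventually_eq (β := (coeff₂ P 1 0 * r + coeff₂ P 0 1 * s : ℚ))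
      (γ := (coeff₂ P 0 0 : ℚ)) ?_
    filter_upwards [Filter.eventually_ge_atTop N] with n hn
    have h1 := hP (r * n) (s * n) (hn.trans (Nat.le_mul_of_pos_left n hr))
      (hn.trans (Nat.le_mul_of_pos_left n hs))
    have h2 : (len (I ^ (r * n) * J ^ (s * n)) : ℚ) = (α * r ^ 2 + β * (r * s) + γ * s ^ 2) * n ^ 2
        + (coeff₂ P 1 0 * r + coeff₂ P 0 1 * s) * n + coeff₂ P 0 0 := by
      rw [h1]; push_cast; ring
    exact_mod_cast h2
  have hα0 : 0 ≤ α := by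
    have : (0 : ℝ) ≤ α := ge_of_tendsto' hα fun n => by positivity
    exact_mod_cast this
  have hγ0 : 0 ≤ γ := by
    have : (0 : ℝ) ≤ γ := ge_of_tendsto' hγ fun n => by positivity
    exact_mod_cast this
  -- If β < 0, then for r > γ/(-β) the ideal I^(rn) J^n would have asymptotically smaller colength
  -- than the larger ideal I^(rn).
  have hβ0 : 0 ≤ β := by
    by_contra! hneg
    obtain ⟨r, hr⟩ := exists_nat_gt (γ / -β)
    have h1 := le_of_tendsto_of_tendsto' (hα.comp_affine 0 r.succ_pos) (hL _ r.succ_pos 1 one_pos)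
      fun n => by
        simp only [zero_add, one_mul]
        gcongr
        exact len_antitone (colen_powMulPow_ne_top hIrad hJrad (_, n)) Ideal.mul_le_left
    have h2 : α * (r.succ : ℚ) ^ 2 ≤ α * r.succ ^ 2 + β * (r.succ * (1 : ℕ)) + γ * (1 : ℕ) ^ 2 := by
      exact_mod_cast h1
    rw [div_lt_iff₀ (by linarith)] at hr
    push_cast at h2
    linarith
  obtain ⟨k, hk, hmix⟩ := exists_mixed_le hdim hIrad hJrad hα hγ hL
  have hsq := sq_le_of_forall_mul_le hα0 hβ0 hγ0 hk hmix
  have hd : krullDimNat R = 2 := by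
    rw [krullDimNat, hdim]; rfl
  have hseq : ∀ (K : Ideal R) (δ : ℚ), HasQuadraticLimit (fun n => len (K ^ n)) δ →
      Filter.Tendsto (multiplicitySeq K) Filter.atTop (nhds (2 * δ : ℝ)) := by
    intro K δ h
    refine (h.const_mul 2).congr fun n => ?_
    rw [multiplicitySeq, hd, ← mul_div_assoc]
    rfl
  have eI : hilbertSamuelMultiplicity I = 2 * α := (hseq I α hα).limUnder_eq
  have eJ : hilbertSamuelMultiplicity J = 2 * γ := (hseq J γ hγ).limUnder_eq
  have emix : mixedMultiplicity ![I, J] ![1, 1] = β := by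
    have hex : ∃ P, IsMultigradedHilbertPolynomial ![I, J] P := ⟨P, hHilb⟩
    rw [mixedMultiplicity, dif_pos hex, hex.choose_spec.unique hHilb, hβdef, coeff₂]
    simp
  refine ⟨⟨P, hHilb, le_antisymm hdeg ?_⟩, eI ▸ hseq I α hα, eJ ▸ hseq J γ hγ, ?_⟩
  -- In degree below 2 the quadratic coefficients vanish and R/I^n grows at most linearly.
  · by_contra! hlt
    have hzero : ∀ i j, 2 ≤ i + j → coeff₂ P i j = 0 := fun i j hij => by
      refine MvPolynomial.coeff_eq_zero_of_totalDegree_lt ?_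
      change _ < Finsupp.sum _ fun _ e => e
      rw [Finsupp.sum_fintype _ _ (by simp), Fin.sum_univ_two]
      simp
      omega
    obtain ⟨C, hC⟩ := exists_linear_bound (α := coeff₂ P 1 0)
      (β := coeff₂ P 0 1 * N + coeff₂ P 0 0) (N := N) hIrad fun n hn => by
        have h1 : (len (I ^ n) : ℚ) ≤ len (I ^ n * J ^ N) := by
          exact_mod_cast len_antitone (colen_powMulPow_ne_top hIrad hJrad (n, N)) Ideal.mul_le_left
        rw [hP n N hn le_rfl, show α = 0 from hzero _ _ le_rfl, show β = 0 from hzero _ _ le_rfl,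
          show γ = 0 from hzero _ _ le_rfl] at h1
        linarith
    exact not_exists_len_pow_le_linear hdim hIrad hC
  · rw [emix, eI, eJ]
    have : (β : ℝ) ^ 2 ≤ 4 * α * γ := by exact_mod_cast hsq
    linarith
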